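/- A *complete operator system* is a closed linear subspace $X$ of a unital $C^*$-algebra $A\neq 0$ that contains $1_A$ and is invariant under the adjoint. A *state* on $X$ is a linear functional $\mu\colon X\to\mathbb C$ with $\mu(1)=1$ that is nonnegative on those elements of $X$ that are positive in $A$; the set $\mathcal S(X)$ of states carries the weak$^*$ topology. A *compact quantum metric space* $(X,L)$ is a complete operator system $X$ with a *Lip-norm* $L$, i.e. a $*$-invariant seminorm $L\colon X\to[0,\infty]$ with $L(1)=0$, finite on a dense subset, such that $d_L(\mu,\nu)=\sup\{|\mu(x)-\nu(x)| : L(x)\le 1\}$ is a metric inducing the weak$^*$ topology on $\mathcal S(X)$. For compact quantum metric spaces $(X,L_X)$ and $(Y,L_Y)$ let * $\mathrm{dist}_{\mathrm{GH}}(X,Y)$ be the classical Gromov–Hausdorff distance of the compact metric spaces $(\mathcal S(X),d_{L_X})$ and $(\mathcal S(Y),d_{L_Y})$; * $\mathrm{dist}^{\mathrm Q}_{\mathrm{GH}}(X,Y)$ be Rieffel's quantum Gromov–Hausdorff distance: the infimum, over all Lip-norms $L$ on $X\oplus Y$ whose domain of finiteness is $\mathrm{dom}(L_X)\oplus\mathrm{dom}(L_Y)$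 and whose quotient seminorms on the self-adjoint parts $X_{\mathrm{sa}}$ and $Y_{\mathrm{sa}}$ are $L_X$ and $L_Y$, of the Hausdorff distance with respect to $d_L$ between the copies of $\mathcal S(X)$ and $\mathcal S(Y)$ in $\mathcal S(X\oplus Y)$ given by the coordinate projections. For real $p\ge 1$ and $N\in\mathbb N$ let $K_p^N$ be the closed unit ball of $(\mathbb R^N,\|\cdot\|_p)$ with the metric $\|x-y\|_p$, let $X_p^N$ be the closure in $C(K_p^N,\mathbb C)$ of the affine Lipschitz functions, and let $L_p^N$ be the Lipschitz constant of functions in $X_p^N$ (which is a Lip-norm). **Theorem.** The metrics $\mathrm{dist}^{\mathrm Q}_{\mathrm{GH}}$ and $\mathrm{dist}_{\mathrm{GH}}$ are not equivalent: there is no constant $C>0$ such that $\mathrm{dist}^{\mathrm Q}_{\mathrm{GH}}(X,Y)\le C\cdot\mathrm{dist}_{\mathrm{GH}}(X,Y)$ for all compact quantum metric spaces $X,Y$. More precisely: 1. For all real $p\ge1$ and $N\in\mathbb N$, the state space $(\mathcal S(X_p^N),d_{L_p^N})$ is affinely isometric to $K_p^N$. 2. For every sequence $(p_n)$ in $(1,2)$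 with $p_n\to1$ there are $M_n\in\mathbb N$ such that for every choice of natural numbers $N_n\ge M_n$ one has $$\lim_{n\to\infty}\mathrm{dist}_{\mathrm{GH}}\big(X_{p_n}^{N_n},X_1^{N_n}\big)=0\quad\text{and}\quad \mathrm{dist}^{\mathrm Q}_{\mathrm{GH}}\big(X_{p_n}^{N_n},X_1^{N_n}\big)\ge\tfrac14\ \text{ for all } n .$$ -/

import Mathlib

open scoped ENNReal NNReal ComplexOrder Topology
open Filter Set

noncomputable section

/-- A complete operator system in a unital C*-algebra `A`: a closed linear subspace that is
invariant under the adjoint operation and contains the unit of `A`. -/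
structure OperatorSystem (A : Type*) [CStarAlgebra A] extends Submodule ℂ A where
  isClosed' : IsClosed carrier
  star_mem' : ∀ {x : A}, x ∈ carrier → star x ∈ carrier
  one_mem' : (1 : A) ∈ carrier

namespace OperatorSystem

instance {A : Type*} [CStarAlgebra A] : CoeSort (OperatorSystem A) (Type _) :=
  ⟨fun X => X.toSubmodule⟩

variable {A : Type*} [CStarAlgebra A] (X : OperatorSystem A)

instance : One X := ⟨⟨1, X.one_mem'⟩⟩

instance : Star X := ⟨fun x => ⟨star (x : A), X.star_mem' x.2⟩⟩

@[simp] theorem coe_one : ((1 : X) : A) = 1 := rfl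

@[simp] theorem coe_star (x : X) : ((star x : X) : A) = star (x : A) := rfl

/-- The direct sum `X ⊕ Y`, as an operator system in the product C*-algebra `A × B`. -/
def prod {B : Type*} [CStarAlgebra B] (X : OperatorSystem A) (Y : OperatorSystem B) :
    OperatorSystem (A × B) where
  toSubmodule := X.toSubmodule.prod Y.toSubmodule
  isClosed' := X.isClosed'.prod Y.isClosed'
  star_mem' := fun h => ⟨X.star_mem' h.1, Y.star_mem' h.2⟩
  one_mem' := ⟨X.one_mem', Y.one_mem'⟩

section Prod

variable {B : Type*} [CStarAlgebra B] {X} {Y : OperatorSystem B}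

/-- The element `(x, y)` of `X ⊕ Y`. -/
def pair (x : X) (y : Y) : X.prod Y := ⟨((x : A), (y : B)), ⟨x.2, y.2⟩⟩

/-- The coordinate projection `X ⊕ Y → X`. -/
def fst (z : X.prod Y) : X := ⟨(z : A × B).1, z.2.1⟩

/-- The coordinate projection `X ⊕ Y → Y`. -/
def snd (z : X.prod Y) : Y := ⟨(z : A × B).2, z.2.2⟩

end Prod

end OperatorSystem

/-- A state on an operator system: a unital linear functional that is nonnegative on the elements
which are positive in the ambient C*-algebra (i.e. of the form `a* a`). -/
structure State {A : Type*} [CStarAlgebra A] (X : OperatorSystem A) where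
  toFun : X →ₗ[ℂ] ℂ
  map_one' : toFun 1 = 1
  nonneg' : ∀ x : X, (∃ a : A, (x : A) = star a * a) → 0 ≤ toFun x

namespace State

variable {A : Type*} [CStarAlgebra A] {X : OperatorSystem A}

instance : CoeFun (State X) (fun _ => X → ℂ) := ⟨fun μ => μ.toFun⟩

@[ext] theorem ext {μ ν : State X} (h : ∀ x, μ x = ν x) : μ = ν := by
  cases μ; cases ν; congr; exact LinearMap.ext h

/-- The weak* topology (pointwise convergence on the operator system). -/
instance : TopologicalSpace (State X) :=
  TopologicalSpace.induced (fun μ => (μ : X → ℂ)) inferInstance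

theorem isEmbedding_coe : Topology.IsEmbedding (fun μ : State X => (μ : X → ℂ)) :=
  ⟨⟨rfl⟩, fun _ _ h => ext (congrFun h)⟩

/-- For self-adjoint `x`, the element `‖x‖ + x` is of the form `a* a`. -/
theorem exists_norm_add {x : A} (hx : IsSelfAdjoint x) :
    ∃ a : A, (‖x‖ : ℂ) • (1 : A) + x = star a * a := by
  let _ := CStarAlgebra.spectralOrder A
  let _ := CStarAlgebra.spectralOrderedRing A
  rw [← CStarAlgebra.nonneg_iff_eq_star_mul_self]
  have := hx.neg_algebraMap_norm_le_self
  rw [neg_le_iff_add_nonneg] at this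
  rwa [add_comm, Algebra.algebraMap_eq_smul_one, ← Complex.coe_smul] at this

theorem nonneg_norm_add (μ : State X) (x : X) (hx : IsSelfAdjoint (x : A)) :
    0 ≤ (‖(x : A)‖ : ℂ) + μ x := by
  obtain ⟨a, ha⟩ := exists_norm_add hx
  have := μ.nonneg' ((‖(x : A)‖ : ℂ) • (1 : X) + x) ⟨a, by simpa using ha⟩
  simpa [μ.map_one'] using this

theorem selfAdjoint_bound (μ : State X) (x : X) (hx : IsSelfAdjoint (x : A)) :
    (μ x).im = 0 ∧ |(μ x).re| ≤ ‖(x : A)‖ := by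
  have h1 := μ.nonneg_norm_add x hx
  have h2 := μ.nonneg_norm_add (-x) (by simpa using hx.neg)
  rw [Complex.nonneg_iff] at h1 h2
  simp at h1 h2
  exact ⟨h1.2.symm, abs_le.2 ⟨by linarith, by linarith⟩⟩

/-- The real part of an element of an operator system. -/
def rePart (x : X) : X := (2⁻¹ : ℂ) • (x + star x)

/-- The imaginary part of an element of an operator system. -/
def imPart (x : X) : X := (-Complex.I * 2⁻¹ : ℂ) • (x - star x)

theorem isSelfAdjoint_rePart (x : X) : IsSelfAdjoint (rePart x : A) := by
  simp [rePart, IsSelfAdjoint, star_smul, add_comm]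

theorem isSelfAdjoint_imPart (x : X) : IsSelfAdjoint (imPart x : A) := by
  simp only [imPart, IsSelfAdjoint, Submodule.coe_smul, Submodule.coe_sub,
    OperatorSystem.coe_star, star_smul, star_sub, star_star]
  rw [← neg_sub (x : A), smul_neg, ← neg_smul]
  congr 1
  simp

theorem rePart_add_imPart (x : X) : x = rePart x + Complex.I • imPart x := by
  rw [rePart, imPart, smul_smul]
  have : Complex.I * (-Complex.I * 2⁻¹) = (2⁻¹ : ℂ) := by
    rw [← mul_assoc, mul_neg, Complex.I_mul_I]; norm_num
  rw [this, ← smul_add]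
  have h : x + star x + (x - star x) = (2 : ℂ) • x := by rw [two_smul]; abel
  rw [h, smul_smul]; norm_num

theorem re_apply (μ : State X) (x : X) : (μ x).re = (μ (rePart x)).re := by
  conv_lhs => rw [rePart_add_imPart x]
  have := (μ.selfAdjoint_bound _ (isSelfAdjoint_imPart x)).1
  simp [this]

theorem norm_re_le (x : X) : ‖(rePart x : A)‖ ≤ ‖(x : A)‖ := by
  simp only [rePart, Submodule.coe_smul, Submodule.coe_add, OperatorSystem.coe_star, norm_smul]
  have := norm_add_le (x : A) (star (x : A))
  rw [norm_star] at this
  norm_num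
  linarith

theorem norm_im_le (x : X) : ‖(imPart x : A)‖ ≤ ‖(x : A)‖ := by
  simp only [imPart, Submodule.coe_smul, Submodule.coe_sub, OperatorSystem.coe_star, norm_smul]
  have := norm_sub_le (x : A) (star (x : A))
  rw [norm_star] at this
  norm_num
  linarith

theorem norm_le (μ : State X) (x : X) : ‖μ x‖ ≤ 2 * ‖(x : A)‖ := by
  have h1 := μ.selfAdjoint_bound _ (isSelfAdjoint_rePart x)
  have h2 := μ.selfAdjoint_bound _ (isSelfAdjoint_imPart x)
  have e : μ x = μ (rePart x) + Complex.I * μ (imPart x) := by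
    conv_lhs => rw [rePart_add_imPart x]
    simp
  rw [e]
  refine (norm_add_le _ _).trans ?_
  rw [norm_mul, Complex.norm_I, one_mul]
  have n1 : ‖μ (rePart x)‖ ≤ ‖(x : A)‖ := by
    rw [Complex.norm_eq_sqrt_sq_add_sq, h1.1]
    simpa [Real.sqrt_sq_eq_abs] using h1.2.trans (norm_re_le x)
  have n2 : ‖μ (imPart x)‖ ≤ ‖(x : A)‖ := by
    rw [Complex.norm_eq_sqrt_sq_add_sq, h2.1]
    simpa [Real.sqrt_sq_eq_abs] using h2.2.trans (norm_im_le x)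
  linarith

theorem isClosed_range_coe : IsClosed (range (fun μ : State X => (μ : X → ℂ))) := by
  have : range (fun μ : State X => (μ : X → ℂ)) =
      (⋂ (x : X) (y : X), {f : X → ℂ | f (x + y) = f x + f y}) ∩
      (⋂ (c : ℂ) (x : X), {f : X → ℂ | f (c • x) = c * f x}) ∩
      {f : X → ℂ | f 1 = 1} ∩
      (⋂ (x : X) (_ : ∃ a : A, (x : A) = star a * a), {f : X → ℂ | 0 ≤ f x}) := by
    ext f
    simp only [mem_range, mem_inter_iff, mem_iInter, mem_ofPred_eq]
    constructor
    · rintro ⟨μ, rfl⟩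
      exact ⟨⟨⟨fun x y => map_add _ _ _, fun c x => map_smul _ _ _⟩, μ.map_one'⟩, μ.nonneg'⟩
    · rintro ⟨⟨⟨h1, h2⟩, h3⟩, h4⟩
      exact ⟨⟨⟨⟨f, h1⟩, h2⟩, h3, h4⟩, rfl⟩
  rw [this]
  refine ((IsClosed.inter ?_ ?_).inter ?_).inter ?_
  · exact isClosed_iInter fun x => isClosed_iInter fun y => isClosed_eq (by fun_prop) (by fun_prop)
  · exact isClosed_iInter fun c => isClosed_iInter fun x => isClosed_eq (by fun_prop) (by fun_prop)
  · exact isClosed_eq (by fun_prop) (by fun_prop)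
  · exact isClosed_iInter fun x => isClosed_iInter fun _ =>
      isClosed_le continuous_const (continuous_apply x)

instance : CompactSpace (State X) := by
  refine ⟨?_⟩
  rw [isEmbedding_coe.isCompact_iff, image_univ]
  refine IsCompact.of_isClosed_subset
    (isCompact_univ_pi fun x : X => isCompact_closedBall (0 : ℂ) (2 * ‖(x : A)‖))
    isClosed_range_coe ?_
  rintro _ ⟨μ, rfl⟩ x _
  simpa using μ.norm_le x

instance [Nontrivial A] : Nonempty (State X) := by
  obtain ⟨g, hg1, hg2⟩ := exists_dual_vector ℂ (1 : A) (by simp)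
  have hb : ∀ a : A, ‖g a‖ ≤ ‖a‖ := fun a => by simpa [hg1] using g.le_opNorm a
  have h1 : g 1 = 1 := by simpa using hg2
  refine ⟨⟨g.toLinearMap ∘ₗ X.toSubmodule.subtype, by simpa using h1, ?_⟩⟩
  rintro x ⟨a, ha⟩
  have hsa : IsSelfAdjoint (x : A) := by rw [ha]; exact IsSelfAdjoint.star_mul_self a
  change 0 ≤ g (x : A)
  generalize (x : A) = x at ha hsa
  have him : (g x).im = 0 := by
    have key : ∀ s : ℝ, ((g x).im + s) ^ 2 ≤ ‖x‖ ^ 2 + s ^ 2 := by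
      intro s
      have hn : ‖x + (s * Complex.I : ℂ) • (1 : A)‖ ^ 2 ≤ ‖x‖ ^ 2 + s ^ 2 := by
        rw [sq, ← CStarRing.norm_star_mul_self]
        have : star (x + (s * Complex.I : ℂ) • (1 : A)) * (x + (s * Complex.I : ℂ) • (1 : A))
            = x * x + ((s ^ 2 : ℝ) : ℂ) • (1 : A) := by
          rw [star_add, hsa.star_eq, star_smul, star_one]
          simp only [add_mul, mul_add, smul_mul_assoc, mul_smul_comm, one_mul, mul_one]
          have e1 : star (s * Complex.I : ℂ) = -(s * Complex.I) := by simp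
          have e2 : (s * Complex.I) * -(s * Complex.I) = ((s ^ 2 : ℝ) : ℂ) := by
            push_cast; linear_combination (-(s : ℂ) ^ 2) * Complex.I_sq
          rw [e1, smul_add, smul_smul, e2, neg_smul]; abel
        rw [this]
        refine (norm_add_le _ _).trans ?_
        rw [norm_smul, norm_one, mul_one, sq ‖x‖]
        refine add_le_add (norm_mul_le _ _) ?_
        rw [Complex.norm_real, Real.norm_of_nonneg (by positivity)]
      have h2 := hb (x + (s * Complex.I : ℂ) • (1 : A))
      rw [map_add, map_smul, h1] at h2
      have h3 : |(g x).im + s| ≤ ‖g x + (s * Complex.I : ℂ) • (1 : ℂ)‖ := by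
        have := Complex.abs_im_le_norm (g x + (s * Complex.I : ℂ) • (1 : ℂ))
        simpa using this
      calc ((g x).im + s) ^ 2 = |(g x).im + s| ^ 2 := (sq_abs _).symm
        _ ≤ ‖x + (s * Complex.I : ℂ) • (1 : A)‖ ^ 2 := by gcongr; exact h3.trans h2
        _ ≤ _ := hn
    by_contra hne
    have := key ((‖x‖ ^ 2 + 1) / (g x).im)
    have e : ((g x).im + (‖x‖ ^ 2 + 1) / (g x).im) ^ 2 =
        (g x).im ^ 2 + 2 * (‖x‖ ^ 2 + 1) + ((‖x‖ ^ 2 + 1) / (g x).im) ^ 2 := by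
      field_simp
      ring
    rw [e] at this
    nlinarith [sq_nonneg (g x).im, sq_nonneg ‖x‖]
  have hre : ‖(‖x‖ : ℂ) • (1 : A) - x‖ ≤ ‖x‖ := by
    let _ := CStarAlgebra.spectralOrder A
    let _ := CStarAlgebra.spectralOrderedRing A
    have hx0 : 0 ≤ x := CStarAlgebra.nonneg_iff_eq_star_mul_self.2 ⟨a, ha⟩
    have hle := hsa.le_algebraMap_norm_self
    rw [Algebra.algebraMap_eq_smul_one, ← Complex.coe_smul] at hle
    have := CStarAlgebra.norm_le_norm_of_nonneg_of_le (sub_nonneg.2 hle) (sub_le_self _ hx0)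
    refine this.trans ?_
    rw [norm_smul, norm_one, mul_one, Complex.norm_real, norm_norm]
  have h4 := (hb _).trans hre
  rw [map_sub, map_smul, h1] at h4
  have h5 := (Complex.abs_re_le_norm _).trans h4
  simp only [smul_eq_mul, mul_one, Complex.sub_re, Complex.ofReal_re] at h5
  rw [Complex.nonneg_iff]
  exact ⟨by linarith [(abs_le.1 h5).2], him.symm⟩

variable {B : Type*} [CStarAlgebra B] {Y : OperatorSystem B}

/-- The embedding `S(X) → S(X ⊕ Y)` dual to the coordinate projection. -/
def inl (μ : State X) : State (X.prod Y) where
  toFun :=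
    { toFun := fun z => μ (OperatorSystem.fst z)
      map_add' := fun z w => μ.toFun.map_add (OperatorSystem.fst z) (OperatorSystem.fst w)
      map_smul' := fun c z => μ.toFun.map_smul c (OperatorSystem.fst z) }
  map_one' := μ.map_one'
  nonneg' := fun z ⟨a, ha⟩ => μ.nonneg' (OperatorSystem.fst z) ⟨a.1, congrArg Prod.fst ha⟩

/-- The embedding `S(Y) → S(X ⊕ Y)` dual to the coordinate projection. -/
def inr (ν : State Y) : State (X.prod Y) where
  toFun :=
    { toFun := fun z => ν (OperatorSystem.snd z)
      map_add' := fun z w => ν.toFun.map_add (OperatorSystem.snd z) (OperatorSystem.snd w)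
      map_smul' := fun c z => ν.toFun.map_smul c (OperatorSystem.snd z) }
  map_one' := ν.map_one'
  nonneg' := fun z ⟨a, ha⟩ => ν.nonneg' (OperatorSystem.snd z) ⟨a.2, congrArg Prod.snd ha⟩

end State

/-- The Connes metric `d_L(μ, ν) = sup {|μ(x) - ν(x)| : L(x) ≤ 1}`, with values in `[0, ∞]`. -/
def connesDist {A : Type*} [CStarAlgebra A] {X : OperatorSystem A} (L : X → ℝ≥0∞)
    (μ ν : State X) : ℝ≥0∞ :=
  ⨆ (x : X) (_ : L x ≤ 1), ENNReal.ofReal ‖μ x - ν x‖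

/-- `L : X → [0, ∞]` is a Lip-norm: a `*`-invariant seminorm vanishing at the unit, finite on a
dense subset, whose Connes metric is a metric inducing the weak* topology on the state space. -/
structure IsLipNorm {A : Type*} [CStarAlgebra A] (X : OperatorSystem A) (L : X → ℝ≥0∞) :
    Prop where
  add_le : ∀ x y, L (x + y) ≤ L x + L y
  smul : ∀ (c : ℂ) x, L (c • x) = ENNReal.ofReal ‖c‖ * L x
  star : ∀ x, L (star x) = L x
  one : L 1 = 0
  dense : Dense {x : X | L x < ∞}
  metrizes : ∃ m : MetricSpace (State X),
    m.toUniformSpace.toTopologicalSpace = State.instTopologicalSpace ∧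
    ∀ μ ν, connesDist L μ ν = ENNReal.ofReal (m.dist μ ν)

/-- The metric `d_L` on the state space, as a metric space structure (whose topology is, by
definition, the weak* topology). -/
@[reducible] def IsLipNorm.metricSpace {A : Type*} [CStarAlgebra A] {X : OperatorSystem A}
    {L : X → ℝ≥0∞} (h : IsLipNorm X L) : MetricSpace (State X) :=
  MetricSpace.replaceTopology
    { dist := fun μ ν => (connesDist L μ ν).toReal
      dist_self := fun μ => by
        obtain ⟨m, -, hm⟩ := h.metrizes
        rw [hm, dist_self, ENNReal.ofReal_zero, ENNReal.toReal_zero]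
      dist_comm := fun μ ν => by
        obtain ⟨m, -, hm⟩ := h.metrizes
        rw [hm, hm, dist_comm]
      dist_triangle := fun μ ν ρ => by
        obtain ⟨m, -, hm⟩ := h.metrizes
        simp only [hm, ENNReal.toReal_ofReal dist_nonneg]
        exact dist_triangle _ _ _
      eq_of_dist_eq_zero := fun {μ ν} e => by
        obtain ⟨m, -, hm⟩ := h.metrizes
        simp only [hm, ENNReal.toReal_ofReal dist_nonneg] at e
        exact eq_of_dist_eq_zero e } (by
      obtain ⟨m, ht, hm⟩ := h.metrizes
      refine ht.symm.trans ?_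
      congr 2
      congr 1
      refine MetricSpace.ext ?_
      ext μ ν
      exact (by rw [hm, ENNReal.toReal_ofReal (@dist_nonneg _ m.toPseudoMetricSpace μ ν)] :
        m.dist μ ν = (connesDist L μ ν).toReal))

/-- A compact quantum metric space: a (nonzero) complete operator system with a Lip-norm. -/
structure CompactQuantumMetricSpace where
  A : Type
  [cstar : CStarAlgebra A]
  [nontriv : Nontrivial A]
  X : OperatorSystem A
  L : X → ℝ≥0∞
  isLipNorm : IsLipNorm X L

namespace CompactQuantumMetricSpace

instance (𝒳 : CompactQuantumMetricSpace) : CStarAlgebra 𝒳.A := 𝒳.cstar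

instance (𝒳 : CompactQuantumMetricSpace) : Nontrivial 𝒳.A := 𝒳.nontriv

/-- The state space of a compact quantum metric space, a compact metric space for `d_L`. -/
def StateSpace (𝒳 : CompactQuantumMetricSpace) : Type := State 𝒳.X

instance (𝒳 : CompactQuantumMetricSpace) : CoeFun 𝒳.StateSpace (fun _ => 𝒳.X → ℂ) :=
  ⟨fun μ => State.toFun μ⟩

instance (𝒳 : CompactQuantumMetricSpace) : MetricSpace 𝒳.StateSpace :=
  𝒳.isLipNorm.metricSpace

instance (𝒳 : CompactQuantumMetricSpace) : CompactSpace 𝒳.StateSpace :=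
  inferInstanceAs (CompactSpace (State 𝒳.X))

instance (𝒳 : CompactQuantumMetricSpace) : Nonempty 𝒳.StateSpace :=
  inferInstanceAs (Nonempty (State 𝒳.X))

/-- The classical Gromov-Hausdorff distance of the state spaces. -/
def distGH (𝒳 𝒴 : CompactQuantumMetricSpace) : ℝ :=
  GromovHausdorff.ghDist 𝒳.StateSpace 𝒴.StateSpace

/-- Admissibility of `L : X ⊕ Y → [0, ∞]`: it is a Lip-norm, its domain is the sum of the domains
of `L_X` and `L_Y`, and its quotient seminorms on the self-adjoint parts are `L_X` and `L_Y`. -/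
structure Admissible (𝒳 𝒴 : CompactQuantumMetricSpace) (L : 𝒳.X.prod 𝒴.X → ℝ≥0∞) : Prop where
  isLipNorm : IsLipNorm (𝒳.X.prod 𝒴.X) L
  dom : ∀ (x : 𝒳.X) (y : 𝒴.X),
    L (OperatorSystem.pair x y) < ∞ ↔ 𝒳.L x < ∞ ∧ 𝒴.L y < ∞
  quotient_left : ∀ x : 𝒳.X, IsSelfAdjoint (x : 𝒳.A) →
    ⨅ (y : 𝒴.X) (_ : IsSelfAdjoint (y : 𝒴.A)), L (OperatorSystem.pair x y) = 𝒳.L x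
  quotient_right : ∀ y : 𝒴.X, IsSelfAdjoint (y : 𝒴.A) →
    ⨅ (x : 𝒳.X) (_ : IsSelfAdjoint (x : 𝒳.A)), L (OperatorSystem.pair x y) = 𝒴.L y

/-- The Hausdorff distance, for `d_L`, of the copies of `S(X)` and `S(Y)` in `S(X ⊕ Y)`. -/
def stateHausdorffDist (𝒳 𝒴 : CompactQuantumMetricSpace) (L : 𝒳.X.prod 𝒴.X → ℝ≥0∞)
    (h : Admissible 𝒳 𝒴 L) : ℝ :=
  letI := h.isLipNorm.metricSpace
  Metric.hausdorffDist (range (State.inl : State 𝒳.X → State (𝒳.X.prod 𝒴.X)))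
    (range (State.inr : State 𝒴.X → State (𝒳.X.prod 𝒴.X)))

/-- Rieffel's quantum Gromov-Hausdorff distance. -/
def distQGH (𝒳 𝒴 : CompactQuantumMetricSpace) : ℝ :=
  sInf {r | ∃ (L : 𝒳.X.prod 𝒴.X → ℝ≥0∞) (h : Admissible 𝒳 𝒴 L), r = stateHausdorffDist 𝒳 𝒴 L h}

end CompactQuantumMetricSpace


section Affine

variable {V : Type} [NormedAddCommGroup V] [NormedSpace ℝ V] (K : Set V) [CompactSpace K]

/-- `f : K → ℂ` respects convex combinations. -/
def IsAffineFun {K : Set V} (f : K → ℂ) : Prop :=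
  ∀ (x y z : K) (t : ℝ), 0 ≤ t → t ≤ 1 → (z : V) = (1 - t) • (x : V) + t • (y : V) →
    f z = (1 - t) * f x + t * f y

/-- The space of affine Lipschitz functions on `K`. -/
def lipAff : Submodule ℂ C(K, ℂ) where
  carrier := {f | IsAffineFun f ∧ ∃ C : ℝ≥0, LipschitzWith C f}
  zero_mem' := ⟨fun x y z t _ _ _ => by simp, 0, LipschitzWith.const 0⟩
  add_mem' := by
    rintro f g ⟨hf, C, hC⟩ ⟨hg, D, hD⟩
    refine ⟨fun x y z t h0 h1 h => ?_, C + D, hC.add hD⟩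
    have h2 := hf x y z t h0 h1 h
    have h3 := hg x y z t h0 h1 h
    simp only [ContinuousMap.add_apply, h2, h3]; ring
  smul_mem' := by
    rintro c f ⟨hf, C, hC⟩
    refine ⟨fun x y z t h0 h1 h => ?_, ‖c‖₊ * C, ?_⟩
    · have h2 := hf x y z t h0 h1 h
      simp only [ContinuousMap.smul_apply, smul_eq_mul, h2]; ring
    · exact (lipschitzWith_smul c).comp hC

/-- The operator system of `K`: the closure of the affine Lipschitz functions in `C(K, ℂ)`. -/
def affSystem : OperatorSystem C(K, ℂ) where
  toSubmodule := (lipAff K).topologicalClosure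
  isClosed' := (lipAff K).isClosed_topologicalClosure
  star_mem' := fun {f} hf => by
    refine map_mem_closure (f := star) continuous_star hf ?_
    rintro g ⟨hg, C, hC⟩
    refine ⟨fun x y z t h0 h1 h => ?_, C, fun x y => ?_⟩
    · have h2 := congrArg (starRingEnd ℂ) (hg x y z t h0 h1 h)
      simpa using h2
    · simpa [edist_dist, dist_eq_norm, ← map_sub] using hC x y
  one_mem' := (lipAff K).le_topologicalClosure
    ⟨fun x y z t _ _ _ => by simp, 0, LipschitzWith.const 1⟩

/-- The Lipschitz constant of a function in the operator system of `K`. -/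
def lipConst (f : affSystem K) : ℝ≥0∞ :=
  ⨆ (x : K) (y : K), edist ((f : C(K, ℂ)) x) ((f : C(K, ℂ)) y) / edist x y

variable {K}

theorem lipConst_le_iff (f : affSystem K) (C : ℝ≥0∞) :
    lipConst K f ≤ C ↔
      ∀ x y : K, edist ((f : C(K, ℂ)) x) ((f : C(K, ℂ)) y) ≤ C * edist x y := by
  simp only [lipConst, iSup_le_iff]
  refine forall_congr' fun x => forall_congr' fun y => ?_
  rcases eq_or_ne x y with rfl | h
  · simp
  · exact ENNReal.div_le_iff (by simpa using h) (edist_ne_top _ _)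

theorem edist_le_lipConst (f : affSystem K) (x y : K) :
    edist ((f : C(K, ℂ)) x) ((f : C(K, ℂ)) y) ≤ lipConst K f * edist x y :=
  (lipConst_le_iff f _).1 le_rfl x y

theorem isAffineFun_affSystem (f : affSystem K) : IsAffineFun (f : C(K, ℂ)) := by
  intro x y z t h0 h1 h
  have hc : IsClosed {g : C(K, ℂ) | g z = (1 - t) * g x + t * g y} := by
    refine isClosed_eq ?_ ?_ <;> fun_prop
  have : closure ((lipAff K : Set C(K, ℂ))) ⊆ {g : C(K, ℂ) | g z = (1 - t) * g x + t * g y} :=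
    closure_minimal (fun g hg => hg.1 x y z t h0 h1 h) hc
  exact this f.2

/-- Evaluation at a point of `K`, as a state. -/
def evalState (k : K) : State (affSystem K) where
  toFun :=
    { toFun := fun f => (f : C(K, ℂ)) k
      map_add' := fun _ _ => rfl
      map_smul' := fun _ _ => rfl }
  map_one' := rfl
  nonneg' := by
    rintro x ⟨a, ha⟩
    change 0 ≤ (x : C(K, ℂ)) k
    rw [ha]
    exact star_mul_self_nonneg (a k)

@[simp] theorem evalState_apply (k : K) (f : affSystem K) : evalState k f = (f : C(K, ℂ)) k := rfl

theorem continuous_evalState : Continuous (evalState : K → State (affSystem K)) := by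
  rw [State.isEmbedding_coe.continuous_iff]
  exact continuous_pi fun f => (f : C(K, ℂ)).continuous

/-- The restriction to `K` of a continuous real functional, as an element of the system. -/
def dualElem (φ : V →L[ℝ] ℝ) : affSystem K :=
  ⟨⟨fun k => (φ k : ℂ), by fun_prop⟩, (lipAff K).le_topologicalClosure (by
    refine ⟨fun x y z t _ _ h => ?_, ‖φ‖₊, fun x y => ?_⟩
    · simp [h]
    · have := φ.lipschitz x y
      simpa [edist_dist, Complex.dist_eq, ← Complex.ofReal_sub, Real.dist_eq, Subtype.dist_eq] using this)⟩

theorem lipConst_dualElem (φ : V →L[ℝ] ℝ) (h : ‖φ‖ ≤ 1) : lipConst K (dualElem φ) ≤ 1 := by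
  rw [lipConst_le_iff]
  intro x y
  have := φ.lipschitz x y
  have h' : (‖φ‖₊ : ℝ≥0∞) ≤ 1 := by exact_mod_cast h
  have h2 := this.trans (mul_le_mul_left h' _)
  simpa [dualElem, edist_dist, Complex.dist_eq, ← Complex.ofReal_sub, Real.dist_eq,
    Subtype.dist_eq] using h2

theorem connesDist_evalState (x y : K) :
    connesDist (lipConst K) (evalState x) (evalState y) = ENNReal.ofReal (dist x y) := by
  apply le_antisymm
  · refine iSup₂_le fun f hf => ?_
    have := (lipConst_le_iff f 1).1 hf x y
    rwa [one_mul, edist_dist, edist_dist, dist_eq_norm] at this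
  · obtain ⟨φ, h1, h2⟩ := exists_dual_vector'' ℝ ((x : V) - y)
    refine le_trans ?_ (le_iSup₂ (dualElem φ) (lipConst_dualElem φ h1))
    apply ENNReal.ofReal_le_ofReal
    have : (φ x : ℂ) - φ y = ((‖(x : V) - y‖ : ℝ) : ℂ) := by
      rw [← Complex.ofReal_sub, ← map_sub, h2]; rfl
    change dist x y ≤ ‖(φ x : ℂ) - φ y‖
    rw [this, Complex.norm_real, norm_norm, Subtype.dist_eq, dist_eq_norm]

theorem exists_finset_eval [Nonempty K] (hK : Convex ℝ K) (μ : State (affSystem K))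
    (s : Finset (affSystem K)) : ∃ k : K, ∀ f ∈ s, μ f = (f : C(K, ℂ)) k := by
  let F : K → (s → ℂ) := fun k f => (f.1 : C(K, ℂ)) k
  have hF : Continuous F := continuous_pi fun f => (f.1 : C(K, ℂ)).continuous
  have hcomp : IsCompact (range F) := isCompact_range hF
  have hconv : Convex ℝ (range F) := by
    rintro _ ⟨x, rfl⟩ _ ⟨y, rfl⟩ a b ha hb hab
    refine ⟨⟨a • x + b • y, hK x.2 y.2 ha hb hab⟩, ?_⟩
    ext f
    have ha' : a = 1 - b := by linarith
    have hz : ((⟨a • x + b • y, hK x.2 y.2 ha hb hab⟩ : K) : V) =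
        (1 - b) • (x : V) + b • (y : V) := by
      change a • (x : V) + b • (y : V) = _
      rw [ha']
    have := isAffineFun_affSystem f.1 x y ⟨a • x + b • y, hK x.2 y.2 ha hb hab⟩ b hb
      (by linarith) hz
    simp only [F, Pi.add_apply, Pi.smul_apply, Complex.real_smul]
    rw [this, ha']
    push_cast; ring
  by_contra hne
  have hnot : (fun f : s => μ f.1) ∉ range F := by
    rintro ⟨k, hk⟩
    exact hne ⟨k, fun f hf => (congrFun hk ⟨f, hf⟩).symm⟩
  obtain ⟨φ, u, h1, h2⟩ := RCLike.geometric_hahn_banach_closed_point (𝕜 := ℂ) hconv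
    hcomp.isClosed hnot
  classical
  let c : s → ℂ := fun f => φ (Pi.single f 1)
  have hφ : ∀ z : s → ℂ, φ z = ∑ f, c f * z f := by
    intro z
    conv_lhs => rw [pi_eq_sum_univ' z]
    simp only [map_sum, map_smul, smul_eq_mul, c]
    refine Finset.sum_congr rfl fun f _ => ?_
    rw [mul_comm]
  let g : affSystem K := ∑ f : s, c f • f.1
  have hμg : μ g = φ (fun f : s => μ f.1) := by
    rw [hφ]; simp only [g, map_sum, map_smul, smul_eq_mul]
  have hg : ∀ k, (g : C(K, ℂ)) k = φ (F k) := by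
    intro k
    change evalState k g = _
    rw [hφ]; simp only [g, map_sum, map_smul, smul_eq_mul]; rfl
  let r := (u : ℂ) • (1 : affSystem K) - State.rePart g
  have hr : 0 ≤ μ r := by
    apply μ.nonneg'
    refine ⟨⟨fun k => (Real.sqrt (u - ((g : C(K, ℂ)) k).re) : ℂ), by fun_prop⟩, ?_⟩
    ext k
    have hk : ((g : C(K, ℂ)) k).re < u := by rw [hg]; exact h1 _ ⟨k, rfl⟩
    have e : ((Real.sqrt (u - ((g : C(K, ℂ)) k).re) : ℂ)) *
        (Real.sqrt (u - ((g : C(K, ℂ)) k).re) : ℂ) = ((u - ((g : C(K, ℂ)) k).re : ℝ) : ℂ) := by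
      rw [← Complex.ofReal_mul, Real.mul_self_sqrt (by linarith)]
    have e2 : (2⁻¹ : ℂ) * ((g : C(K, ℂ)) k + (starRingEnd ℂ) ((g : C(K, ℂ)) k)) =
        (((g : C(K, ℂ)) k).re : ℂ) := by
      rw [Complex.add_conj]; push_cast; ring
    rw [mul_add] at e2
    simp [r, State.rePart, e, e2, -Complex.ofReal_sub]
    simp
  have h3 : (μ r).re = u - (μ g).re := by
    rw [State.re_apply μ g]
    simp [r, μ.map_one']
  have h4 := (Complex.nonneg_iff.1 hr).1
  rw [h3, hμg] at h4
  have h5 : u < (φ (fun f : s => μ f.1)).re := h2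
  linarith

theorem evalState_bijective [Nonempty K] (hK : Convex ℝ K) :
    Function.Bijective (evalState : K → State (affSystem K)) := by
  constructor
  · intro x y h
    have := connesDist_evalState x y
    rw [h, connesDist_evalState, dist_self, ENNReal.ofReal_zero] at this
    exact dist_le_zero.1 (ENNReal.ofReal_eq_zero.1 this.symm)
  · intro μ
    have : (⋂ f : affSystem K, {k : K | μ f = (f : C(K, ℂ)) k}).Nonempty := by
      apply CompactSpace.iInter_nonempty
      · exact fun f => isClosed_eq continuous_const (f : C(K, ℂ)).continuous
      · intro s
        obtain ⟨k, hk⟩ := exists_finset_eval hK μ s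
        exact ⟨k, by simpa using hk⟩
    obtain ⟨k, hk⟩ := this
    exact ⟨k, State.ext fun f => ((mem_iInter.1 hk f)).symm⟩

theorem isLipNorm_lipConst [Nonempty K] (hK : Convex ℝ K) :
    IsLipNorm (affSystem K) (lipConst K) where
  add_le f g := by
    rw [lipConst_le_iff]
    intro x y
    rw [add_mul]
    exact (edist_add_add_le _ _ _ _).trans
      (add_le_add (edist_le_lipConst f x y) (edist_le_lipConst g x y))
  smul c f := by
    simp only [lipConst, ENNReal.mul_iSup]
    refine iSup_congr fun x => iSup_congr fun y => ?_
    rw [← mul_div_assoc]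
    congr 1
    simp [edist_dist, dist_eq_norm, ← mul_sub, ENNReal.ofReal_mul]
  star f := by
    simp only [lipConst]
    refine iSup_congr fun x => iSup_congr fun y => ?_
    congr 1
    simp [edist_dist, dist_eq_norm, ← map_sub]
  one := by simp [lipConst]
  dense := by
    have hd : Dense ((↑) ⁻¹' (lipAff K : Set C(K, ℂ)) : Set (affSystem K)) := by
      intro f
      rw [closure_subtype]
      have : ((↑) '' ((↑) ⁻¹' (lipAff K : Set C(K, ℂ)) : Set (affSystem K)) : Set C(K, ℂ)) =
          lipAff K := by
        exact (Subtype.image_preimage_coe _ _).trans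
          (inter_eq_right.2 (lipAff K).le_topologicalClosure)
      rw [this]
      exact f.2
    refine hd.mono fun f hf => ?_
    obtain ⟨C, hC⟩ := hf.2
    exact ((lipConst_le_iff f C).2 hC).trans_lt ENNReal.coe_lt_top
  metrizes := by
    let e := Equiv.ofBijective _ (evalState_bijective hK)
    have : T2Space (State (affSystem K)) := State.isEmbedding_coe.t2Space
    let h : K ≃ₜ State (affSystem K) :=
      Continuous.homeoOfEquivCompactToT2 (f := e) continuous_evalState
    refine ⟨MetricSpace.induced h.symm h.symm.injective inferInstance, ?_, ?_⟩
    · exact h.symm.isInducing.eq_induced.symm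
    · intro μ ν
      obtain ⟨x, rfl⟩ := h.surjective μ
      obtain ⟨y, rfl⟩ := h.surjective ν
      refine (connesDist_evalState x y).trans ?_
      change _ = ENNReal.ofReal (dist (h.symm (h x)) (h.symm (h y)))
      simp

variable (K) in
/-- The compact quantum metric space of a nonempty compact convex set `K`. -/
def affQMS [Nonempty K] (hK : Convex ℝ K) : CompactQuantumMetricSpace where
  A := C(K, ℂ)
  X := affSystem K
  L := lipConst K
  isLipNorm := isLipNorm_lipConst hK

end Affine

section EllBall

/-- The closed unit ball of `ℝ^N` with the `p`-norm. -/
abbrev ellBall (p : ℝ≥0∞) [Fact (1 ≤ p)] (N : ℕ) : Set (PiLp p (fun _ : Fin N => ℝ)) :=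
  Metric.closedBall 0 1

instance (p : ℝ≥0∞) [Fact (1 ≤ p)] (N : ℕ) : CompactSpace (ellBall p N) :=
  isCompact_iff_compactSpace.1 (isCompact_closedBall _ _)

instance (p : ℝ≥0∞) [Fact (1 ≤ p)] (N : ℕ) : Nonempty (ellBall p N) :=
  ⟨⟨0, Metric.mem_closedBall_self zero_le_one⟩⟩

/-- The compact quantum metric space `X_p^N` of the closed unit ball of `(ℝ^N, ‖·‖_p)`. -/
def ellQMS (p : ℝ) (hp : 1 ≤ p) (N : ℕ) : CompactQuantumMetricSpace :=
  haveI : Fact (1 ≤ ENNReal.ofReal p) := ⟨ENNReal.one_le_ofReal.2 hp⟩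
  affQMS (ellBall (ENNReal.ofReal p) N) (convex_closedBall _ _)

/-- The state space is affinely isometric to the closed unit ball of `ℝ^N` in the `p`-norm. -/
def StateSpaceIsEllBall (𝒳 : CompactQuantumMetricSpace) (p : ℝ) (N : ℕ) : Prop :=
  ∃ e : {x : Fin N → ℝ // (∑ i, |x i| ^ p) ^ (1 / p) ≤ 1} ≃ 𝒳.StateSpace,
    (∀ x y, dist (e x) (e y) = (∑ i, |x.1 i - y.1 i| ^ p) ^ (1 / p)) ∧
    ∀ x y z, ∀ t : ℝ, 0 ≤ t → t ≤ 1 → z.1 = (1 - t) • x.1 + t • y.1 →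
      ∀ f, e z f = (1 - t) * e x f + t * e y f

end EllBall

end

/-! The two distances separate because `K_p^N` and `K_1^N` are close as metric spaces, uniformly in
`N`, but only through a nonlinear map, whereas elements of an operator system are affine functions
on the state space.

Classical side: the coordinatewise Mazur map `t ↦ sign(t)|t|^p` sends `K_p^N` onto `K_1^N`. By
`abs_sub_mazur_le` the error in each coordinate is at most `2^(p-1) - 1` times `|s|^p + |t|^p`;
summed over a pair in the unit ball this is at most `2 (2^(p-1) - 1)`, whatever `N` is. Passing from
`d^p` to `d` costs another term that vanishes as `p → 1` (`abs_rpow_sub_self_le`).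

Quantum side: suppose some admissible `L` gives Hausdorff distance below `1/4`. Then the vertices
`e_j` and `-e_j` of `K_1^N` have close partners `w_j` and `w'_j` in `K_p^N`. For `p ≤ 2` the space
`ℓ_p` has type `p` with constant one, so signs `ε_j` exist with `‖∑ ε_j (w_j - w'_j)/2‖_p ≤ N^(1/p)`
(`exists_signs_sum_abs_rpow_le`). The functional `g(y) = ∑ ε_j y_j` is 1-Lipschitz on `ℓ_1` and
lifts to a pair `(f, g)` with `L(f, g) < 6/5`. Up to the factor `ε_j`, the affine function `f` is
near `1` at `w_j` and near `-1` at `w'_j`. Averaging over `j` gives two points of `K_p^N` where `f`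
differs by at least `7/5`, although their distance is at most `2 N^(1/p) / N ≤ 1` for large `N` and
`f` is `6/5`-Lipschitz: a contradiction (`not_hausdorffDist_lt_quarter`).

The infimum defining the quantum distance must also run over a nonempty set; the bridge seminorm
`bridgeLip` provides an admissible Lip-norm. -/

/-! ### Scalar inequalities: type `p` and the Mazur map -/

section RealInequalities

theorem sq_rpow_half (x p : ℝ) : (x ^ 2) ^ (p / 2) = |x| ^ p := by
  rw [← sq_abs, ← Real.rpow_natCast, ← Real.rpow_mul (abs_nonneg x)]
  congr 1
  push_cast
  ring

/-- The two-point type inequality for exponents `p ≤ 2`. -/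
theorem abs_add_rpow_add_abs_sub_rpow_le {p : ℝ} (hp0 : 0 < p) (hp2 : p ≤ 2) (a b : ℝ) :
    |a + b| ^ p + |a - b| ^ p ≤ 2 * (|a| ^ p + |b| ^ p) := by
  have h0 : 0 ≤ p / 2 := by linarith
  have h1 : p / 2 ≤ 1 := by linarith
  -- The parallelogram law under the exponent `p / 2 ≤ 1`: concavity at the midpoint of `(a + b)^2`
  -- and `(a - b)^2`, then subadditivity on `a^2 + b^2`.
  have hc := (Real.concaveOn_rpow h0 h1).2 (mem_Ici.2 (sq_nonneg (a + b)))
    (mem_Ici.2 (sq_nonneg (a - b))) (show (0 : ℝ) ≤ 1 / 2 by norm_num)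
    (show (0 : ℝ) ≤ 1 / 2 by norm_num) (by norm_num)
  have hs := Real.rpow_add_le_add_rpow (sq_nonneg a) (sq_nonneg b) h0 h1
  have e : (1 / 2 : ℝ) • (a + b) ^ 2 + (1 / 2 : ℝ) • (a - b) ^ 2 = a ^ 2 + b ^ 2 := by
    simp only [smul_eq_mul]
    ring
  rw [e] at hc
  simp only [smul_eq_mul, sq_rpow_half] at hc hs
  linarith

/-- Signs can be chosen so that `ℓ_p` behaves, for `p ≤ 2`, as a space of type `p` with
constant one. -/
theorem exists_signs_sum_abs_rpow_le {ι κ : Type*} [Fintype ι] {p : ℝ} (hp0 : 0 < p) (hp2 : p ≤ 2)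
    (v : κ → ι → ℝ) (s : Finset κ) :
    ∃ ε : κ → ℝ, (∀ j, ε j = 1 ∨ ε j = -1) ∧
      ∑ i, |∑ j ∈ s, ε j * v j i| ^ p ≤ ∑ j ∈ s, ∑ i, |v j i| ^ p := by
  classical
  induction s using Finset.induction_on with
  | empty => exact ⟨fun _ => 1, fun _ => Or.inl rfl, by simp [Real.zero_rpow hp0.ne']⟩
  | insert k s hk ih =>
    obtain ⟨ε, hε, hle⟩ := ih
    have key : ∃ δ : ℝ, (δ = 1 ∨ δ = -1) ∧
        ∑ i, |∑ j ∈ s, ε j * v j i + δ * v k i| ^ p ≤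
          ∑ i, |∑ j ∈ s, ε j * v j i| ^ p + ∑ i, |v k i| ^ p := by
      -- One sign must serve all coordinates, so the two-point inequality is summed over `i` first:
      -- if both signs failed, adding the two failures would contradict it.
      by_contra! hne
      have h1 := hne 1 (Or.inl rfl)
      have h2 := hne (-1) (Or.inr rfl)
      have h3 := Finset.sum_le_sum fun i (_ : i ∈ Finset.univ) =>
        abs_add_rpow_add_abs_sub_rpow_le hp0 hp2 (∑ j ∈ s, ε j * v j i) (v k i)
      simp only [Finset.sum_add_distrib, ← Finset.mul_sum] at h3
      simp only [one_mul, neg_one_mul, ← sub_eq_add_neg] at h1 h2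
      linarith
    obtain ⟨δ, hδ, hδle⟩ := key
    refine ⟨Function.update ε k δ, fun j => ?_, ?_⟩
    · rcases eq_or_ne j k with rfl | h
      · simpa using hδ
      · simpa [h] using hε j
    · have e : ∀ i, ∑ j ∈ insert k s, Function.update ε k δ j * v j i =
          ∑ j ∈ s, ε j * v j i + δ * v k i := by
        intro i
        rw [Finset.sum_insert hk, Function.update_self, add_comm]
        congr 1
        refine Finset.sum_congr rfl fun j hj => ?_
        rw [Function.update_of_ne (ne_of_mem_of_not_mem hj hk)]
      simp only [e]
      rw [Finset.sum_insert hk]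
      linarith

/-- The one-dimensional Mazur map `t ↦ sign(t) |t|^p`. -/
noncomputable def mazur (p t : ℝ) : ℝ := Real.sign t * |t| ^ p

theorem mazur_of_nonneg {p t : ℝ} (hp : 0 < p) (ht : 0 ≤ t) : mazur p t = t ^ p := by
  rcases ht.eq_or_lt with rfl | h
  · simp [mazur, Real.zero_rpow hp.ne']
  · simp [mazur, Real.sign_of_pos h, abs_of_pos h]

theorem mazur_neg (p t : ℝ) : mazur p (-t) = -mazur p t := by
  simp [mazur, Real.sign_neg]

theorem abs_mazur {p : ℝ} (hp : 0 < p) (t : ℝ) : |mazur p t| = |t| ^ p := by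
  rcases le_total 0 t with h | h
  · rw [mazur_of_nonneg hp h, abs_of_nonneg h, abs_of_nonneg (by positivity)]
  · rw [← neg_neg t, mazur_neg, abs_neg, abs_neg, mazur_of_nonneg hp (by linarith),
      abs_of_nonneg (a := -t) (by linarith), abs_of_nonneg (Real.rpow_nonneg (by linarith) _)]

theorem mazur_mazur_inv {p : ℝ} (hp : 0 < p) (t : ℝ) : mazur p (mazur p⁻¹ t) = t := by
  have key : ∀ t : ℝ, 0 ≤ t → mazur p (mazur p⁻¹ t) = t := fun t ht => by
    rw [mazur_of_nonneg (inv_pos.2 hp) ht, mazur_of_nonneg hp (by positivity),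
      Real.rpow_inv_rpow ht hp.ne']
  rcases le_total 0 t with h | h
  · exact key t h
  · have := key (-t) (by linarith)
    rwa [mazur_neg, mazur_neg, neg_inj] at this

theorem add_rpow_le_two_rpow_mul {p b c : ℝ} (hp : 1 ≤ p) (hb : 0 ≤ b) (hc : 0 ≤ c) :
    (b + c) ^ p ≤ 2 ^ (p - 1) * (b ^ p + c ^ p) := by
  lift b to ℝ≥0 using hb
  lift c to ℝ≥0 using hc
  exact_mod_cast NNReal.rpow_add_le_mul_rpow_add_rpow b c hp

/-- The Mazur map is almost isometric for `p` close to `1`. -/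
theorem abs_sub_mazur_le {p : ℝ} (hp : 1 ≤ p) (s t : ℝ) :
    |(|s - t| ^ p - |mazur p s - mazur p t|)| ≤ (2 ^ (p - 1) - 1) * (|s| ^ p + |t| ^ p) := by
  have hp0 : 0 < p := by linarith
  have hη : (0 : ℝ) ≤ 2 ^ (p - 1) - 1 := sub_nonneg.2 (Real.one_le_rpow (by norm_num) (by linarith))
  -- Equal signs: superadditivity and convexity of the power squeeze `s^p` between `t^p + (s-t)^p`
  -- and `2^(p-1)` times that sum. Opposite signs are the same squeeze for `(s+u)^p`, `u = -t`;
  -- symmetry and negation reduce all other cases to these two.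
  have same : ∀ s t : ℝ, 0 ≤ t → t ≤ s →
      |(|s - t| ^ p - |mazur p s - mazur p t|)| ≤ (2 ^ (p - 1) - 1) * (|s| ^ p + |t| ^ p) := by
    intro s t ht hst
    have hs := ht.trans hst
    have h1 := Real.add_rpow_le_rpow_add ht (sub_nonneg.2 hst) hp
    have h2 := add_rpow_le_two_rpow_mul hp ht (sub_nonneg.2 hst)
    rw [add_sub_cancel] at h1 h2
    have h3 : 0 ≤ (s - t) ^ p := Real.rpow_nonneg (by linarith) _
    have h4 : 0 ≤ t ^ p := Real.rpow_nonneg ht _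
    have h5 : (2 ^ (p - 1) - 1) * (t ^ p + (s - t) ^ p) ≤ (2 ^ (p - 1) - 1) * (s ^ p + t ^ p) :=
      mul_le_mul_of_nonneg_left (by linarith) hη
    rw [mazur_of_nonneg hp0 hs, mazur_of_nonneg hp0 ht, abs_of_nonneg (sub_nonneg.2 hst),
      abs_of_nonneg hs, abs_of_nonneg ht, abs_of_nonneg (a := s ^ p - t ^ p) (by linarith), abs_le]
    constructor <;> linarith
  have opp : ∀ s t : ℝ, 0 ≤ s → t ≤ 0 →
      |(|s - t| ^ p - |mazur p s - mazur p t|)| ≤ (2 ^ (p - 1) - 1) * (|s| ^ p + |t| ^ p) := by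
    intro s t hs ht
    obtain ⟨u, rfl⟩ : ∃ u, t = -u := ⟨-t, by simp⟩
    have hu : 0 ≤ u := by linarith
    have h1 := Real.add_rpow_le_rpow_add hs hu hp
    have h2 := add_rpow_le_two_rpow_mul hp hs hu
    have h3 : 0 ≤ s ^ p := Real.rpow_nonneg hs _
    have h4 : 0 ≤ u ^ p := Real.rpow_nonneg hu _
    rw [mazur_neg, sub_neg_eq_add, sub_neg_eq_add, mazur_of_nonneg hp0 hs, mazur_of_nonneg hp0 hu,
      abs_neg, abs_of_nonneg (add_nonneg hs hu), abs_of_nonneg hs, abs_of_nonneg hu,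
      abs_of_nonneg (add_nonneg h3 h4), abs_le]
    constructor <;> linarith
  have symm : ∀ s t : ℝ,
      |(|s - t| ^ p - |mazur p s - mazur p t|)| ≤ (2 ^ (p - 1) - 1) * (|s| ^ p + |t| ^ p) →
      |(|t - s| ^ p - |mazur p t - mazur p s|)| ≤ (2 ^ (p - 1) - 1) * (|t| ^ p + |s| ^ p) := by
    intro s t h
    rwa [abs_sub_comm t s, abs_sub_comm (mazur p t), add_comm (|t| ^ p)]
  have negs : ∀ s t : ℝ,
      |(|-s - -t| ^ p - |mazur p (-s) - mazur p (-t)|)| ≤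
        (2 ^ (p - 1) - 1) * (|-s| ^ p + |-t| ^ p) →
      |(|s - t| ^ p - |mazur p s - mazur p t|)| ≤ (2 ^ (p - 1) - 1) * (|s| ^ p + |t| ^ p) := by
    intro s t h
    rwa [mazur_neg, mazur_neg, neg_sub_neg, neg_sub_neg, abs_sub_comm t s,
      abs_sub_comm (mazur p t), abs_neg, abs_neg] at h
  rcases le_total 0 s with hs | hs <;> rcases le_total 0 t with ht | ht
  · rcases le_total t s with h | h
    · exact same s t ht h
    · exact symm t s (same t s hs h)
  · exact opp s t hs ht
  · exact symm t s (opp t s ht hs)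
  · refine negs s t ?_
    rcases le_total s t with h | h
    · exact same _ _ (by linarith) (by linarith)
    · exact symm _ _ (same _ _ (by linarith) (by linarith))

/-- Below `1`, Bernoulli's inequality gives `u - u^p ≤ (p-1)(1-u)`; above `1`, `u^p - u = u (u^(p-1)
- 1)` with `u ≤ 2`. The bound is the sum of the two, and it tends to `0` as `p → 1`. -/
theorem abs_rpow_sub_self_le {p u : ℝ} (hp : 1 ≤ p) (hu : 0 ≤ u) (hu2 : u ≤ 2) :
    |u ^ p - u| ≤ 2 * (2 ^ (p - 1) - 1) + (p - 1) := by
  have hη : (0 : ℝ) ≤ 2 ^ (p - 1) - 1 := sub_nonneg.2 (Real.one_le_rpow (by norm_num) (by linarith))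
  rcases le_total u 1 with h | h
  · have h1 := one_add_mul_self_le_rpow_one_add (s := u - 1) (by linarith) hp
    rw [add_sub_cancel] at h1
    have h2 : u ^ p ≤ u := Real.rpow_le_self_of_le_one hu h hp
    rw [abs_le]
    constructor <;> nlinarith
  · have h1 : u ≤ u ^ p := Real.self_le_rpow_of_one_le h hp
    have h2 : u ^ p = u * u ^ (p - 1) := by
      rw [← Real.rpow_one_add' hu (by linarith)]
      congr 1
      ring
    have h3 : u ^ (p - 1) ≤ 2 ^ (p - 1) := Real.rpow_le_rpow hu hu2 (by linarith)
    rw [abs_of_nonneg (by linarith), h2]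
    nlinarith

end RealInequalities

/-! ### Rieffel's compactness criterion for Lip-norms -/

section LipNorm

/-- A compact topology has no strictly coarser Hausdorff topology. -/
theorem TopologicalSpace.eq_of_le_of_compactSpace {α : Type*} {t₁ t₂ : TopologicalSpace α}
    (h₁ : @CompactSpace α t₁) (h₂ : @T2Space α t₂) (hle : t₁ ≤ t₂) : t₁ = t₂ := by
  have hc : @Topology.IsClosedEmbedding α α t₁ t₂ id :=
    @Continuous.isClosedEmbedding α α t₁ t₂ h₁ h₂ id (continuous_id_iff_le.2 hle)
      Function.injective_id
  have := (@Topology.isInducing_iff α α t₁ t₂ id).1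
    (@Topology.IsClosedEmbedding.isInducing α α id t₁ t₂ hc)
  rw [this, induced_id]

variable {A : Type*} [CStarAlgebra A] {X : OperatorSystem A} {L : X → ℝ≥0∞}

/-- Rieffel's criterion: a `*`-invariant, densely finite seminorm is a Lip-norm if the elements of
its unit ball that vanish at some state lie in a compact set. -/
theorem IsLipNorm.of_isCompact (add_le : ∀ x y, L (x + y) ≤ L x + L y)
    (smul : ∀ (c : ℂ) x, L (c • x) = ENNReal.ofReal ‖c‖ * L x) (hstar : ∀ x, L (Star.star x) = L x)
    (one : L 1 = 0) (dense : Dense {x : X | L x < ∞}) (φ : State X) {C : Set A}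
    (hC : IsCompact C) (h : ∀ x, L x ≤ 1 → φ x = 0 → (x : A) ∈ C) : IsLipNorm X L := by
  -- Subtracting the scalar `φ x` preserves `L x ≤ 1` and all differences of states, so the Connes
  -- metric is a supremum over elements of the compact set `C`.
  have shift : ∀ x, L x ≤ 1 → ∃ x' : X, L x' ≤ 1 ∧ (x' : A) ∈ C ∧
      ∀ μ ν : State X, μ x - ν x = μ x' - ν x' := by
    intro x hx
    have h1 : L (x + (-(φ x)) • (1 : X)) ≤ 1 := by
      refine (add_le _ _).trans ?_
      rwa [smul, one, mul_zero, add_zero]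
    refine ⟨_, h1, h _ h1 ?_, fun μ ν => ?_⟩
    · simp [φ.map_one']
    · simp [μ.map_one', ν.map_one']
  obtain ⟨R, hR⟩ := hC.isBounded.exists_norm_le
  have fin : ∀ μ ν : State X, connesDist L μ ν ≠ ∞ := by
    intro μ ν
    refine ne_top_of_le_ne_top (ENNReal.ofReal_ne_top (r := 4 * R)) (iSup₂_le fun x hx => ?_)
    obtain ⟨x', -, hx', e⟩ := shift x hx
    rw [e]
    apply ENNReal.ofReal_le_ofReal
    have h1 := μ.norm_le x'
    have h2 := ν.norm_le x'
    have h3 := hR _ hx'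
    exact (norm_sub_le _ _).trans (by linarith)
  have self : ∀ μ : State X, connesDist L μ μ = 0 := fun μ => by simp [connesDist]
  have comm : ∀ μ ν : State X, connesDist L μ ν = connesDist L ν μ := fun μ ν => by
    simp only [connesDist, norm_sub_rev]
  have tri : ∀ μ ν ρ : State X, connesDist L μ ρ ≤ connesDist L μ ν + connesDist L ν ρ := by
    intro μ ν ρ
    refine iSup₂_le fun x hx => ?_
    refine (ENNReal.ofReal_le_ofReal (norm_sub_le_norm_sub_add_norm_sub (μ x) (ν x) (ρ x))).trans ?_
    rw [ENNReal.ofReal_add (norm_nonneg _) (norm_nonneg _)]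
    exact add_le_add (le_iSup₂ (f := fun (x : X) (_ : L x ≤ 1) => ENNReal.ofReal ‖μ x - ν x‖) x hx)
      (le_iSup₂ (f := fun (x : X) (_ : L x ≤ 1) => ENNReal.ofReal ‖ν x - ρ x‖) x hx)
  have sep : ∀ μ ν : State X, connesDist L μ ν = 0 → μ = ν := by
    intro μ ν h0
    have cont : ∀ ρ : State X, Continuous fun x : X => ρ x := fun ρ =>
      (LinearMap.mkContinuous ρ.toFun 2 ρ.norm_le).continuous
    have heq : (fun x : X => μ x) = fun x => ν x := by
      refine Continuous.ext_on dense (cont μ) (cont ν) fun x hx => ?_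
      -- The summand `1` keeps the rescaling factor positive when `L x = 0`.
      set r : ℝ := (L x).toReal + 1 with hr
      have hrpos : 0 < r := by positivity
      have hL : L (((r⁻¹ : ℝ) : ℂ) • x) ≤ 1 := by
        rw [smul, Complex.norm_real, Real.norm_of_nonneg (by positivity),
          ← ENNReal.ofReal_toReal hx.ne, ← ENNReal.ofReal_mul (by positivity)]
        apply ENNReal.ofReal_le_one.2
        rw [inv_mul_le_one₀ hrpos, hr]
        linarith
      have h1 : ENNReal.ofReal ‖μ (((r⁻¹ : ℝ) : ℂ) • x) - ν (((r⁻¹ : ℝ) : ℂ) • x)‖ ≤ 0 := by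
        rw [← h0]
        exact le_iSup₂ (f := fun (x : X) (_ : L x ≤ 1) => ENNReal.ofReal ‖μ x - ν x‖) _ hL
      have h2 := norm_le_zero_iff.1 (ENNReal.ofReal_eq_zero.1 (nonpos_iff_eq_zero.1 h1))
      rw [map_smul, map_smul, ← smul_sub, smul_eq_zero] at h2
      rcases h2 with h2 | h2
      · exact absurd (Complex.ofReal_eq_zero.1 h2) (by positivity)
      · exact sub_eq_zero.1 h2
    exact State.ext (congrFun heq)
  let m : MetricSpace (State X) :=
    { dist := fun μ ν => (connesDist L μ ν).toReal
      dist_self := fun μ => by rw [self, ENNReal.toReal_zero]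
      dist_comm := fun μ ν => by rw [comm]
      dist_triangle := fun μ ν ρ => by
        rw [← ENNReal.toReal_add (fin _ _) (fin _ _)]
        exact ENNReal.toReal_mono (ENNReal.add_ne_top.2 ⟨fin _ _, fin _ _⟩) (tri _ _ _)
      eq_of_dist_eq_zero := fun {μ ν} e =>
        sep μ ν ((ENNReal.toReal_eq_zero_iff _).1 e |>.resolve_right (fin _ _)) }
  have hdist : ∀ μ ν, m.dist μ ν = (connesDist L μ ν).toReal := fun _ _ => rfl
  -- It suffices that the metric topology is coarser than the weak* one: the latter is compact and
  -- the former Hausdorff, so they coincide.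
  have hcont : @Continuous _ _ State.instTopologicalSpace m.toUniformSpace.toTopologicalSpace
      (id : State X → State X) := by
    rw [@continuous_iff_continuousAt _ _ State.instTopologicalSpace
      m.toUniformSpace.toTopologicalSpace]
    intro μ
    refine (@Metric.tendsto_nhds _ _ m.toPseudoMetricSpace _ _ _).2 fun ε hε => ?_
    -- Elements of `X` within `ε/16` of the same net point are within `ε/8` of each other. As states
    -- have norm bound `2`, replacing `x'` by `y a` costs `ε/4` for each of `ν` and `μ`; the
    -- difference at `y a` costs another `ε/4`, for a total of `3ε/4`.
    obtain ⟨t, htC, htfin, hcov⟩ := hC.finite_cover_balls (e := ε / 16) (by positivity)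
    have hpick : ∀ a ∈ t, ∃ y : X, ((∃ x : X, dist (x : A) a < ε / 16) →
        dist (y : A) a < ε / 16) := by
      intro a _
      by_cases hx : ∃ x : X, dist (x : A) a < ε / 16
      · exact ⟨hx.choose, fun _ => hx.choose_spec⟩
      -- Net points lie in `A` and may be far from `X`; the value `0` is then never used.
      · exact ⟨0, fun h' => absurd h' hx⟩
    choose! y hy using hpick
    have hev : ∀ᶠ ν in 𝓝 μ, ∀ a ∈ t, ‖ν (y a) - μ (y a)‖ < ε / 4 := by
      refine (eventually_all_finite htfin).2 fun a _ => ?_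
      have hc : Continuous fun ν : State X => ν (y a) :=
        (continuous_apply (y a)).comp State.isEmbedding_coe.continuous
      simpa [dist_eq_norm] using (Metric.tendsto_nhds.1 (hc.tendsto μ)) (ε / 4) (by positivity)
    filter_upwards [hev] with ν hν
    change (connesDist L ν μ).toReal < ε
    refine lt_of_le_of_lt (ENNReal.toReal_le_of_le_ofReal (b := 3 * ε / 4) (by positivity)
      (iSup₂_le fun x hx => ENNReal.ofReal_le_ofReal ?_)) (by linarith)
    obtain ⟨x', -, hx', e⟩ := shift x hx
    rw [e]
    obtain ⟨a, ha, hxa⟩ := mem_iUnion₂.1 (hcov hx')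
    have hya := hy a ha ⟨x', hxa⟩
    have hd : ‖((x' - y a : X) : A)‖ < ε / 8 := by
      rw [Submodule.coe_sub, ← dist_eq_norm]
      have := dist_triangle_right (x' : A) (y a) a
      have hxa' : dist (x' : A) a < ε / 16 := hxa
      linarith
    have h1 := ν.norm_le (x' - y a)
    have h2 := μ.norm_le (x' - y a)
    have h3 := hν a ha
    have e' : ν x' - μ x' = ν (x' - y a) + (ν (y a) - μ (y a)) - μ (x' - y a) := by
      simp only [map_sub]
      ring
    rw [e']
    refine (norm_sub_le _ _).trans ?_
    have := norm_add_le (ν (x' - y a)) (ν (y a) - μ (y a))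
    linarith
  have : @T2Space (State X) m.toUniformSpace.toTopologicalSpace :=
    @TopologicalSpace.t2Space_of_metrizableSpace _ m.toUniformSpace.toTopologicalSpace inferInstance
  exact ⟨add_le, smul, hstar, one, dense, m,
    (TopologicalSpace.eq_of_le_of_compactSpace inferInstance this (continuous_id_iff_le.1 hcont)).symm,
    fun μ ν => by rw [hdist, ENNReal.ofReal_toReal (fin _ _)]⟩

end LipNorm

/-! ### An admissible Lip-norm on the direct sum -/

section Bridge

variable {V W : Type} [NormedAddCommGroup V] [NormedSpace ℝ V] [NormedAddCommGroup W]
  [NormedSpace ℝ W] {K : Set V} {K' : Set W} [CompactSpace K] [CompactSpace K']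

/-- Arzelà–Ascoli: the common Lipschitz constant gives equicontinuity and turns the bound at `k`
into the pointwise bound `dist x k + R`. The Lipschitz condition survives pointwise limits and
forces continuity, hence closedness among all functions. -/
theorem isCompact_lipschitz_bounded_at {Z : Type*} [PseudoMetricSpace Z] [CompactSpace Z] (k : Z)
    (R : ℝ) : IsCompact {f : C(Z, ℂ) | LipschitzWith 1 f ∧ ‖f k‖ ≤ R} := by
  refine ArzelaAscoli.isCompact_of_equicontinuous _ ?_ ?_
  · have hclosed : IsClosed {f : Z → ℂ | LipschitzWith 1 f ∧ ‖f k‖ ≤ R} := by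
      have hk : IsClosed {f : Z → ℂ | ‖f k‖ ≤ R} :=
        isClosed_le (continuous_apply k).norm continuous_const
      exact (isClosed_setOfPred_lipschitzWith 1).inter hk
    have himage : (ContinuousMap.toFun '' {f : C(Z, ℂ) | LipschitzWith 1 f ∧ ‖f k‖ ≤ R}) =
        {f : Z → ℂ | LipschitzWith 1 f ∧ ‖f k‖ ≤ R} := by
      ext f
      constructor
      · rintro ⟨g, hg, rfl⟩
        exact hg
      · exact fun hf => ⟨⟨f, hf.1.continuous⟩, hf, rfl⟩
    rw [himage]
    refine IsCompact.of_isClosed_subset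
      (isCompact_univ_pi fun x : Z => isCompact_closedBall (0 : ℂ) (dist x k + R)) hclosed ?_
    rintro f ⟨hf, hk⟩ x -
    rw [mem_closedBall_zero_iff]
    have h1 := hf.dist_le_mul x k
    rw [NNReal.coe_one, one_mul, dist_eq_norm] at h1
    have h2 := norm_le_norm_sub_add (f x) (f k)
    linarith
  · exact (LipschitzWith.uniformEquicontinuous _ 1 fun f => f.2.1).equicontinuous

/-- The seminorm on the direct sum that joins `K` and `K'` by a bridge between two points. -/
noncomputable def bridgeLip (k : K) (l : K') (z : (affSystem K).prod (affSystem K')) : ℝ≥0∞ :=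
  max (max (lipConst K (OperatorSystem.fst z)) (lipConst K' (OperatorSystem.snd z)))
    (ENNReal.ofReal
      ‖State.inl (evalState k) z - State.inr (evalState l) z‖)

theorem lipConst_fst_le_bridgeLip (k : K) (l : K') (z : (affSystem K).prod (affSystem K')) :
    lipConst K (OperatorSystem.fst z) ≤ bridgeLip k l z :=
  (le_max_left _ _).trans (le_max_left _ _)

theorem lipConst_snd_le_bridgeLip (k : K) (l : K') (z : (affSystem K).prod (affSystem K')) :
    lipConst K' (OperatorSystem.snd z) ≤ bridgeLip k l z :=
  (le_max_right _ _).trans (le_max_left _ _)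

theorem ofReal_norm_sub_le_bridgeLip (k : K) (l : K') (z : (affSystem K).prod (affSystem K')) :
    ENNReal.ofReal ‖State.inl (evalState k) z - State.inr (evalState l) z‖ ≤ bridgeLip k l z :=
  le_max_right _ _

theorem lipschitzWith_of_lipConst_le_one {f : affSystem K} (hf : lipConst K f ≤ 1) :
    LipschitzWith 1 (f : C(K, ℂ)) := fun x y => by
  simpa using (lipConst_le_iff f 1).1 hf x y

theorem isLipNorm_bridgeLip (hK : Convex ℝ K) (hK' : Convex ℝ K') (k : K) (l : K') :
    IsLipNorm ((affSystem K).prod (affSystem K')) (bridgeLip k l) := by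
  have : Nonempty K := ⟨k⟩
  have : Nonempty K' := ⟨l⟩
  have hL := isLipNorm_lipConst hK
  have hL' := isLipNorm_lipConst hK'
  -- Normalising by evaluation at `k` makes the first component vanish there; the bridge term then
  -- bounds the second component by `1` at `l`. Hence the radii `0` and `1`.
  have hC := (isCompact_lipschitz_bounded_at k 0).prod (isCompact_lipschitz_bounded_at l 1)
  refine IsLipNorm.of_isCompact ?_ ?_ ?_ ?_ ?_ (State.inl (evalState k)) hC ?_
  · intro x y
    refine max_le (max_le ?_ ?_) ?_
    · exact (hL.add_le (OperatorSystem.fst x) (OperatorSystem.fst y)).trans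
        (add_le_add (lipConst_fst_le_bridgeLip k l x) (lipConst_fst_le_bridgeLip k l y))
    · exact (hL'.add_le (OperatorSystem.snd x) (OperatorSystem.snd y)).trans
        (add_le_add (lipConst_snd_le_bridgeLip k l x) (lipConst_snd_le_bridgeLip k l y))
    · refine le_trans ?_ (add_le_add (ofReal_norm_sub_le_bridgeLip k l x)
        (ofReal_norm_sub_le_bridgeLip k l y))
      rw [← ENNReal.ofReal_add (norm_nonneg _) (norm_nonneg _), map_add, map_add, add_sub_add_comm]
      exact ENNReal.ofReal_le_ofReal (norm_add_le _ _)
  · intro c x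
    have hmono : Monotone fun y : ℝ≥0∞ => ENNReal.ofReal ‖c‖ * y := fun _ _ h => by
      change _ * _ ≤ _ * _
      gcongr
    have hmul : ∀ a b, ENNReal.ofReal ‖c‖ * max a b = max (ENNReal.ofReal ‖c‖ * a)
        (ENNReal.ofReal ‖c‖ * b) := fun a b => hmono.map_max
    rw [bridgeLip, bridgeLip, hmul, hmul]
    refine congrArg₂ max (congrArg₂ max (hL.smul c (OperatorSystem.fst x))
      (hL'.smul c (OperatorSystem.snd x))) ?_
    rw [← ENNReal.ofReal_mul (norm_nonneg _), ← norm_mul, mul_sub, map_smul, map_smul, smul_eq_mul,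
      smul_eq_mul]
  · intro x
    refine congrArg₂ max (congrArg₂ max (hL.star (OperatorSystem.fst x))
      (hL'.star (OperatorSystem.snd x))) (congrArg ENNReal.ofReal ?_)
    refine Eq.trans ?_ (norm_star _)
    rw [star_sub]
    rfl
  · have h3 : ENNReal.ofReal ‖(1 : ℂ) - 1‖ = 0 := by simp
    refine (congrArg₂ max (congrArg₂ max hL.one hL'.one) h3).trans ?_
    simp
  · have hd := hL.dense.prod hL'.dense
    have hcont : Continuous fun q : affSystem K × affSystem K' =>
        (OperatorSystem.pair q.1 q.2 : (affSystem K).prod (affSystem K')) :=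
      Continuous.subtype_mk (by fun_prop) _
    have hsurj : Function.Surjective fun q : affSystem K × affSystem K' =>
        (OperatorSystem.pair q.1 q.2 : (affSystem K).prod (affSystem K')) :=
      fun z => ⟨(OperatorSystem.fst z, OperatorSystem.snd z), rfl⟩
    refine (hsurj.denseRange.dense_image hcont hd).mono ?_
    rintro _ ⟨q, hq, rfl⟩
    exact max_lt (max_lt hq.1 hq.2) ENNReal.ofReal_lt_top
  · intro x hx h0
    have h1 : lipConst K (OperatorSystem.fst x) ≤ 1 :=
      (lipConst_fst_le_bridgeLip k l x).trans hx
    have h2 : lipConst K' (OperatorSystem.snd x) ≤ 1 :=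
      (lipConst_snd_le_bridgeLip k l x).trans hx
    have h3 := (ofReal_norm_sub_le_bridgeLip k l x).trans hx
    have h0' : evalState k (OperatorSystem.fst x) = 0 := h0
    rw [h0, zero_sub, norm_neg, ENNReal.ofReal_le_one] at h3
    exact ⟨⟨lipschitzWith_of_lipConst_le_one h1, (norm_eq_zero.2 h0').le⟩,
      lipschitzWith_of_lipConst_le_one h2, h3⟩

theorem isSelfAdjoint_smul_one {c : ℂ} (hc : IsSelfAdjoint c) :
    IsSelfAdjoint ((c • (1 : affSystem K) : affSystem K) : C(K, ℂ)) := by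
  change IsSelfAdjoint (c • (1 : C(K, ℂ)))
  exact hc.smul (IsSelfAdjoint.one _)

theorem isSelfAdjoint_evalState {x : affSystem K} (hx : IsSelfAdjoint (x : C(K, ℂ))) (k : K) :
    IsSelfAdjoint (evalState k x) :=
  congrArg (fun f : C(K, ℂ) => f k) hx

/-- The infimum is attained at the constant function with value `x(k)`: it has Lipschitz constant
zero, makes the bridge term vanish, and is self-adjoint since `x(k)` is real. -/
theorem iInf_bridgeLip_left [Nonempty K'] (hK' : Convex ℝ K') (k : K) (l : K') (x : affSystem K)
    (hx : IsSelfAdjoint (x : C(K, ℂ))) :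
    ⨅ (y : affSystem K') (_ : IsSelfAdjoint (y : C(K', ℂ))),
      bridgeLip k l (OperatorSystem.pair x y) = lipConst K x := by
  refine le_antisymm ?_ (le_iInf₂ fun y _ =>
    lipConst_fst_le_bridgeLip k l (OperatorSystem.pair x y))
  have hL' := isLipNorm_lipConst hK'
  have hs := isSelfAdjoint_evalState hx k
  refine (iInf₂_le (evalState k x • (1 : affSystem K')) (isSelfAdjoint_smul_one hs)).trans ?_
  refine max_le (max_le le_rfl ?_) ?_
  · refine le_of_eq_of_le ?_ zero_le
    exact (hL'.smul _ _).trans (by rw [hL'.one, mul_zero])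
  · refine le_of_eq_of_le ?_ zero_le
    change ENNReal.ofReal ‖evalState k x - evalState k x * 1‖ = 0
    simp

theorem iInf_bridgeLip_right [Nonempty K] (hK : Convex ℝ K) (k : K) (l : K') (y : affSystem K')
    (hy : IsSelfAdjoint (y : C(K', ℂ))) :
    ⨅ (x : affSystem K) (_ : IsSelfAdjoint (x : C(K, ℂ))),
      bridgeLip k l (OperatorSystem.pair x y) = lipConst K' y := by
  refine le_antisymm ?_ (le_iInf₂ fun x _ =>
    lipConst_snd_le_bridgeLip k l (OperatorSystem.pair x y))
  have hL := isLipNorm_lipConst hK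
  have hs := isSelfAdjoint_evalState hy l
  refine (iInf₂_le (evalState l y • (1 : affSystem K)) (isSelfAdjoint_smul_one hs)).trans ?_
  refine max_le (max_le ?_ le_rfl) ?_
  · refine le_of_eq_of_le ?_ zero_le
    exact (hL.smul _ _).trans (by rw [hL.one, mul_zero])
  · refine le_of_eq_of_le ?_ zero_le
    change ENNReal.ofReal ‖evalState l y * 1 - evalState l y‖ = 0
    simp

theorem bridgeLip_pair_lt_top_iff (k : K) (l : K') (x : affSystem K) (y : affSystem K') :
    bridgeLip k l (OperatorSystem.pair x y) < ∞ ↔ lipConst K x < ∞ ∧ lipConst K' y < ∞ := by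
  rw [bridgeLip, max_lt_iff, max_lt_iff]
  exact and_iff_left ENNReal.ofReal_lt_top

/-- Needed because `distQGH` is a real `sInf`, equal to `0` on the empty set: without an admissible
Lip-norm no positive lower bound could hold. -/
theorem admissible_bridgeLip [Nonempty K] [Nonempty K'] (hK : Convex ℝ K) (hK' : Convex ℝ K')
    (k : K) (l : K') :
    CompactQuantumMetricSpace.Admissible (affQMS K hK) (affQMS K' hK') (bridgeLip k l) where
  isLipNorm := isLipNorm_bridgeLip hK hK' k l
  dom := bridgeLip_pair_lt_top_iff k l
  quotient_left := iInf_bridgeLip_left hK' k l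
  quotient_right := iInf_bridgeLip_right hK k l

end Bridge

/-! ### Nearby states, affine averages and functionals on `ℓ_1` -/

section LowerBound

open CompactQuantumMetricSpace

/-- If the quantum Gromov-Hausdorff data are `r`-close, each state of `Y` has an `r`-close state
of `X`. -/
theorem exists_state_norm_sub_le {𝒳 𝒴 : CompactQuantumMetricSpace} {L : 𝒳.X.prod 𝒴.X → ℝ≥0∞}
    (h : Admissible 𝒳 𝒴 L) {r : ℝ} (hr : stateHausdorffDist 𝒳 𝒴 L h < r) (ν : State 𝒴.X) :
    ∃ μ : State 𝒳.X, ∀ (z : 𝒳.X.prod 𝒴.X) (c : ℝ), 0 < c → L z ≤ ENNReal.ofReal c →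
      ‖State.inl μ z - State.inr ν z‖ ≤ c * r := by
  let := h.isLipNorm.metricSpace
  have hcomp : CompactSpace (State (𝒳.X.prod 𝒴.X)) := State.instCompactSpace
  have hX : Nonempty (State 𝒳.X) := inferInstance
  have hY : Nonempty (State 𝒴.X) := inferInstance
  have hne := Metric.hausdorffEDist_ne_top_of_nonempty_of_bounded
    (range_nonempty (State.inr : State 𝒴.X → State (𝒳.X.prod 𝒴.X)))
    (range_nonempty (State.inl : State 𝒳.X → State (𝒳.X.prod 𝒴.X)))
    (isCompact_univ.isBounded.subset (subset_univ _))
    (isCompact_univ.isBounded.subset (subset_univ _))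
  have hr' : Metric.hausdorffDist (range (State.inr : State 𝒴.X → State (𝒳.X.prod 𝒴.X)))
      (range (State.inl : State 𝒳.X → State (𝒳.X.prod 𝒴.X))) < r := by
    rw [Metric.hausdorffDist_comm]
    exact hr
  obtain ⟨_, ⟨μ, rfl⟩, hμ⟩ := Metric.exists_dist_lt_of_hausdorffDist_lt (mem_range_self ν) hr' hne
  rw [dist_comm] at hμ
  have hr0 : 0 < r := dist_nonneg.trans_lt hμ
  -- The metric is the `toReal` of the Connes distance, so an infinite value, read as `0`, has to be
  -- excluded.
  have hfin : connesDist L (State.inl μ) (State.inr ν : State (𝒳.X.prod 𝒴.X)) ≠ ∞ := by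
    obtain ⟨m, -, hm⟩ := h.isLipNorm.metrizes
    rw [hm]
    exact ENNReal.ofReal_ne_top
  have hlt : connesDist L (State.inl μ) (State.inr ν : State (𝒳.X.prod 𝒴.X)) ≤ ENNReal.ofReal r := by
    rw [← ENNReal.ofReal_toReal hfin]
    exact ENNReal.ofReal_le_ofReal (show (connesDist L _ _).toReal < r from hμ).le
  refine ⟨μ, fun z c hc hz => ?_⟩
  have hz' : L (((c⁻¹ : ℝ) : ℂ) • z) ≤ 1 := by
    rw [h.isLipNorm.smul, Complex.norm_real, Real.norm_of_nonneg (by positivity)]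
    refine (mul_le_mul_right hz _).trans ?_
    rw [← ENNReal.ofReal_mul (by positivity), inv_mul_cancel₀ hc.ne', ENNReal.ofReal_one]
  have h1 := (le_iSup₂ (f := fun (x : 𝒳.X.prod 𝒴.X) (_ : L x ≤ 1) =>
    ENNReal.ofReal ‖State.inl μ x - State.inr ν x‖) _ hz').trans hlt
  rw [ENNReal.ofReal_le_ofReal_iff hr0.le, map_smul, map_smul, ← smul_sub, norm_smul,
    Complex.norm_real, Real.norm_of_nonneg (by positivity), inv_mul_le_iff₀ hc] at h1
  exact h1

variable {V : Type} [NormedAddCommGroup V] [NormedSpace ℝ V] {K : Set V} [CompactSpace K]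

/-- Affinity on segments makes the real part both convex and concave, so Jensen's inequality holds
in both directions. -/
theorem re_affSystem_sum (hK : Convex ℝ K) (f : affSystem K) {ι : Type*} (s : Finset ι) (c : ι → ℝ)
    (hc0 : ∀ i ∈ s, 0 ≤ c i) (hc1 : ∑ i ∈ s, c i = 1) (u : ι → K) (z : K)
    (hz : (z : V) = ∑ i ∈ s, c i • (u i : V)) :
    ((f : C(K, ℂ)) z).re = ∑ i ∈ s, c i * ((f : C(K, ℂ)) (u i)).re := by
  classical
  let F : V → ℝ := fun x => if h : x ∈ K then ((f : C(K, ℂ)) ⟨x, h⟩).re else 0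
  have hF : ∀ x : K, F x = ((f : C(K, ℂ)) x).re := fun x => by simp [F]
  have haff : ∀ ⦃x⦄, x ∈ K → ∀ ⦃y⦄, y ∈ K → ∀ ⦃a b : ℝ⦄, 0 ≤ a → 0 ≤ b → a + b = 1 →
      F (a • x + b • y) = a • F x + b • F y := by
    intro x hx y hy a b ha hb hab
    have h1 := isAffineFun_affSystem f ⟨x, hx⟩ ⟨y, hy⟩ ⟨_, hK hx hy ha hb hab⟩ b hb
      (by linarith) (by rw [← hab, add_sub_cancel_right])
    have h2 := congrArg Complex.re h1
    have ha' : a = 1 - b := by linarith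
    rw [← Complex.ofReal_one, ← Complex.ofReal_sub, Complex.add_re, Complex.re_ofReal_mul,
      Complex.re_ofReal_mul, ← hF, ← hF, ← hF, ← ha'] at h2
    exact h2
  have hconv : ConvexOn ℝ K F := ⟨hK, fun x hx y hy a b ha hb hab => (haff hx hy ha hb hab).le⟩
  have hconc : ConcaveOn ℝ K F := ⟨hK, fun x hx y hy a b ha hb hab => (haff hx hy ha hb hab).ge⟩
  have h1 := hconv.map_sum_le hc0 hc1 (p := fun i => (u i : V)) fun i _ => (u i).2
  have h2 := hconc.le_map_sum hc0 hc1 (p := fun i => (u i : V)) fun i _ => (u i).2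
  rw [← hz] at h1 h2
  simpa only [hF, smul_eq_mul] using le_antisymm h1 h2

theorem norm_piLp_ofReal {p : ℝ} (hp : 0 < p) {N : ℕ}
    (x : PiLp (ENNReal.ofReal p) (fun _ : Fin N => ℝ)) :
    ‖x‖ = (∑ i, |x i| ^ p) ^ (1 / p) := by
  rw [PiLp.norm_eq_sum (by rwa [ENNReal.toReal_ofReal hp.le]), ENNReal.toReal_ofReal hp.le]
  rfl

/-- `ellQMS 1` carries the exponent `ENNReal.ofReal 1`, which is not syntactically `1`. -/
instance fact_one_le_ofReal_one : Fact (1 ≤ ENNReal.ofReal 1) := ⟨by simp⟩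

/-- The functional `y ↦ ∑ ε_j y_j` on `ℓ_1`, for a vector `ε` in the cube. -/
theorem exists_norm_le_one_of_abs_le_one {N : ℕ} {ε : Fin N → ℝ} (hε : ∀ j, |ε j| ≤ 1) :
    ∃ φ : PiLp (ENNReal.ofReal 1) (fun _ : Fin N => ℝ) →L[ℝ] ℝ, ‖φ‖ ≤ 1 ∧
      ∀ y, φ y = ∑ j, ε j * y j := by
  let ψ : PiLp (ENNReal.ofReal 1) (fun _ : Fin N => ℝ) →ₗ[ℝ] ℝ :=
    { toFun := fun y => ∑ j, ε j * y j
      map_add' := fun x y => by simp [mul_add, Finset.sum_add_distrib]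
      map_smul' := fun c x => by simp [Finset.mul_sum, mul_left_comm] }
  refine ⟨ψ.mkContinuous 1 fun y => ?_, ψ.mkContinuous_norm_le zero_le_one _, fun y => rfl⟩
  rw [one_mul, norm_piLp_ofReal one_pos]
  simp only [Real.rpow_one, one_div_one]
  change |∑ j, ε j * y j| ≤ _
  refine (Finset.abs_sum_le_sum_abs _ _).trans (Finset.sum_le_sum fun j _ => ?_)
  rw [abs_mul]
  exact mul_le_of_le_one_left (abs_nonneg _) (hε j)

theorem norm_toLp_single {p : ℝ} (hp : 0 < p) {N : ℕ} (j : Fin N) :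
    ‖(WithLp.toLp (ENNReal.ofReal p) (Pi.single j (1 : ℝ)) :
      PiLp (ENNReal.ofReal p) (fun _ : Fin N => ℝ))‖ = 1 := by
  rw [norm_piLp_ofReal hp]
  have : ∀ i, |(Pi.single j (1 : ℝ) : Fin N → ℝ) i| ^ p = if i = j then 1 else 0 := by
    intro i
    rcases eq_or_ne i j with rfl | h
    · simp
    · simp [h, Real.zero_rpow hp.ne']
  simp [this]

end LowerBound

/-! ### The lower bound for the quantum distance -/

section QuantumDistance

open CompactQuantumMetricSpace

theorem rpow_one_div_le_one_iff {p S : ℝ} (hp : 0 < p) (hS : 0 ≤ S) : S ^ (1 / p) ≤ 1 ↔ S ≤ 1 := by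
  rw [one_div, Real.rpow_inv_le_iff_of_pos hS zero_le_one hp, Real.one_rpow]

theorem norm_piLp_le_one_iff {p : ℝ} (hp : 0 < p) {N : ℕ}
    (x : PiLp (ENNReal.ofReal p) (fun _ : Fin N => ℝ)) : ‖x‖ ≤ 1 ↔ ∑ i, |x i| ^ p ≤ 1 := by
  rw [norm_piLp_ofReal hp, rpow_one_div_le_one_iff hp (by positivity)]

theorem not_hausdorffDist_lt_quarter {p : ℝ} (hp1 : 1 ≤ p) (hp2 : p ≤ 2) {N : ℕ} (hN0 : 0 < N)
    (hN : 2 * (N : ℝ) ^ (1 / p) ≤ N)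
    (L : (ellQMS p hp1 N).X.prod (ellQMS 1 le_rfl N).X → ℝ≥0∞)
    (h : Admissible (ellQMS p hp1 N) (ellQMS 1 le_rfl N) L) :
    ¬ stateHausdorffDist (ellQMS p hp1 N) (ellQMS 1 le_rfl N) L h < 1 / 4 := by
  intro hr
  have : Fact (1 ≤ ENNReal.ofReal p) := ⟨ENNReal.one_le_ofReal.2 hp1⟩
  have hp0 : 0 < p := by linarith
  have hNpos : (0 : ℝ) < N := by exact_mod_cast hN0
  have hK : Convex ℝ (ellBall (ENNReal.ofReal p) N) := convex_closedBall _ _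
  -- The point `x` depends on `y` alone and serves all pairs `(f, g)`, so the signs and the
  -- functional can be chosen after it. The level `6/5` leaves room above `1` because the quotient
  -- infimum need not be attained; `3/10 = 6/5 * 1/4`.
  have near : ∀ y : ellBall (ENNReal.ofReal 1) N, ∃ x : ellBall (ENNReal.ofReal p) N,
      ∀ (f : affSystem (ellBall (ENNReal.ofReal p) N))
        (g : affSystem (ellBall (ENNReal.ofReal 1) N)),
        L (OperatorSystem.pair f g) ≤ ENNReal.ofReal (6 / 5) →
        ‖(f : C(ellBall (ENNReal.ofReal p) N, ℂ)) x - (g : C(ellBall (ENNReal.ofReal 1) N, ℂ)) y‖ ≤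
          3 / 10 := by
    intro y
    obtain ⟨μ, hμ⟩ := exists_state_norm_sub_le h hr (evalState y)
    obtain ⟨x, rfl⟩ := (evalState_bijective hK).2 μ
    refine ⟨x, fun f g hfg => (hμ (OperatorSystem.pair f g) (6 / 5) (by norm_num) hfg).trans ?_⟩
    norm_num
  let e : Fin N → ellBall (ENNReal.ofReal 1) N := fun j =>
    ⟨WithLp.toLp _ (Pi.single j 1), by
      rw [mem_closedBall_zero_iff]
      exact (norm_toLp_single one_pos j).le⟩
  let e' : Fin N → ellBall (ENNReal.ofReal 1) N := fun j =>
    ⟨-WithLp.toLp _ (Pi.single j 1), by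
      rw [mem_closedBall_zero_iff, norm_neg]
      exact (norm_toLp_single one_pos j).le⟩
  choose w hw using fun j => near (e j)
  choose w' hw' using fun j => near (e' j)
  let v : Fin N → Fin N → ℝ := fun j i => ((w j).1 i - (w' j).1 i) / 2
  have hv : ∀ j, ∑ i, |v j i| ^ p ≤ 1 := by
    intro j
    have hmem : ‖(2⁻¹ : ℝ) • ((w j).1 - (w' j).1)‖ ≤ 1 := by
      have h1 := mem_closedBall_zero_iff.1 (w j).2
      have h2 := mem_closedBall_zero_iff.1 (w' j).2
      rw [norm_smul, Real.norm_of_nonneg (by norm_num)]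
      linarith [norm_sub_le (w j).1 (w' j).1]
    refine le_of_eq_of_le (Finset.sum_congr rfl fun i _ => ?_)
      ((norm_piLp_le_one_iff hp0 _).1 hmem)
    congr 2
    exact (inv_mul_eq_div 2 _).symm
  obtain ⟨ε, hε, hle⟩ := exists_signs_sum_abs_rpow_le hp0 hp2 v Finset.univ
  have hsum : ∑ i, |∑ j, ε j * v j i| ^ p ≤ N :=
    hle.trans ((Finset.sum_le_sum fun j _ => hv j).trans (by simp))
  obtain ⟨φ, hφ1, hφ⟩ := exists_norm_le_one_of_abs_le_one (ε := ε) fun j => by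
    rcases hε j with h | h <;> simp [h]
  let g : affSystem (ellBall (ENNReal.ofReal 1) N) := dualElem φ
  have hg : IsSelfAdjoint (g : C(ellBall (ENNReal.ofReal 1) N, ℂ)) := by
    ext y
    exact Complex.conj_ofReal _
  have hge : ∀ j, (g : C(ellBall (ENNReal.ofReal 1) N, ℂ)) (e j) = ε j := by
    intro j
    change ((φ (e j) : ℝ) : ℂ) = ε j
    rw [hφ]
    simp [e, Pi.single_apply]
  have hge' : ∀ j, (g : C(ellBall (ENNReal.ofReal 1) N, ℂ)) (e' j) = -ε j := by
    intro j
    change ((φ (e' j) : ℝ) : ℂ) = -ε j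
    rw [hφ]
    simp [e']
  obtain ⟨f, hfsa, hfL⟩ : ∃ f : affSystem (ellBall (ENNReal.ofReal p) N),
      IsSelfAdjoint (f : C(ellBall (ENNReal.ofReal p) N, ℂ)) ∧
      L (OperatorSystem.pair f g) < ENNReal.ofReal (6 / 5) := by
    have hq := h.quotient_right g hg
    have hlt : (ellQMS 1 le_rfl N).L g < ENNReal.ofReal (6 / 5) :=
      (lipConst_dualElem φ hφ1).trans_lt (by norm_num)
    rw [← hq] at hlt
    obtain ⟨f, hf⟩ := iInf_lt_iff.1 hlt
    obtain ⟨hf1, hf2⟩ := iInf_lt_iff.1 hf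
    exact ⟨f, hf1, hf2⟩
  have hflip : lipConst (ellBall (ENNReal.ofReal p) N) f ≤ ENNReal.ofReal (6 / 5) := by
    refine le_trans ?_ hfL.le
    have hq := h.quotient_left f hfsa
    change (ellQMS p hp1 N).L f ≤ _
    rw [← hq]
    exact iInf₂_le g hg
  let F : ellBall (ENNReal.ofReal p) N → ℝ :=
    fun x => ((f : C(ellBall (ENNReal.ofReal p) N, ℂ)) x).re
  have hFw : ∀ j, |F (w j) - ε j| ≤ 3 / 10 := fun j => by
    have h1 := (Complex.abs_re_le_norm _).trans (hw j f g hfL.le)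
    rwa [hge, Complex.sub_re, Complex.ofReal_re] at h1
  have hFw' : ∀ j, |F (w' j) + ε j| ≤ 3 / 10 := fun j => by
    have h1 := (Complex.abs_re_le_norm _).trans (hw' j f g hfL.le)
    rwa [hge', sub_neg_eq_add, Complex.add_re, Complex.ofReal_re] at h1
  -- From each pair, `u j` is the point where `F` is at least `7/10` and `u' j` the one where it is
  -- at most `-7/10`. The swap puts the sign `ε j` into the difference `u j - u' j`, which is what
  -- the type inequality controls.
  let u : Fin N → ellBall (ENNReal.ofReal p) N := fun j => if ε j = 1 then w j else w' j
  let u' : Fin N → ellBall (ENNReal.ofReal p) N := fun j => if ε j = 1 then w' j else w j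
  have hFu : ∀ j, 14 / 10 ≤ F (u j) - F (u' j) := by
    intro j
    have h1 := abs_le.1 (hFw j)
    have h2 := abs_le.1 (hFw' j)
    rcases hε j with h | h
    · rw [h] at h1 h2
      simp only [u, u', h, if_true]
      linarith
    · rw [h] at h1 h2
      simp only [u, u', h, if_neg (show ¬ (-1 : ℝ) = 1 by norm_num)]
      linarith
  have huv : ∀ j i, (u j).1 i - (u' j).1 i = 2 * (ε j * v j i) := by
    intro j i
    rcases hε j with h | h
    · simp only [u, u', v, h, if_true]
      ring
    · simp only [u, u', v, h, if_neg (show ¬ (-1 : ℝ) = 1 by norm_num)]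
      ring
  have hc1 : ∑ _j : Fin N, (N : ℝ)⁻¹ = 1 := by simp [hNpos.ne']
  have hc0 : ∀ j ∈ (Finset.univ : Finset (Fin N)), 0 ≤ (N : ℝ)⁻¹ := fun _ _ => by positivity
  let z : ellBall (ENNReal.ofReal p) N :=
    ⟨∑ j, (N : ℝ)⁻¹ • (u j).1, hK.sum_mem hc0 hc1 fun j _ => (u j).2⟩
  let z' : ellBall (ENNReal.ofReal p) N :=
    ⟨∑ j, (N : ℝ)⁻¹ • (u' j).1, hK.sum_mem hc0 hc1 fun j _ => (u' j).2⟩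
  have hFz : F z = ∑ j, (N : ℝ)⁻¹ * F (u j) := re_affSystem_sum hK f _ _ hc0 hc1 u z rfl
  have hFz' : F z' = ∑ j, (N : ℝ)⁻¹ * F (u' j) := re_affSystem_sum hK f _ _ hc0 hc1 u' z' rfl
  have hlow : 14 / 10 ≤ F z - F z' := by
    rw [hFz, hFz', ← Finset.sum_sub_distrib]
    calc (14 / 10 : ℝ) = ∑ _j : Fin N, (N : ℝ)⁻¹ * (14 / 10) := by
          rw [← Finset.sum_mul, hc1, one_mul]
      _ ≤ _ := Finset.sum_le_sum fun j _ => by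
          rw [← mul_sub]
          exact mul_le_mul_of_nonneg_left (hFu j) (by positivity)
  have hup : F z - F z' ≤ 6 / 5 * dist z z' := by
    have h1 := (lipConst_le_iff f _).1 hflip z z'
    rw [edist_dist, edist_dist, ← ENNReal.ofReal_mul (by norm_num),
      ENNReal.ofReal_le_ofReal_iff (by positivity), dist_eq_norm] at h1
    exact ((le_abs_self _).trans (Complex.abs_re_le_norm _)).trans h1
  -- The difference of the averages is `(2/N) ∑ ε_j v_j`, of norm at most `2 N^(1/p) / N`. With
  -- `hlow` and `hup` this yields `14/10 ≤ 6/5`.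
  have hdist : dist z z' ≤ 1 := by
    have hzz : (z.1 - z'.1 : PiLp (ENNReal.ofReal p) (fun _ : Fin N => ℝ)) =
        (2 * (N : ℝ)⁻¹) • WithLp.toLp _ (fun i => ∑ j, ε j * v j i) := by
      ext i
      have hz : z.1 i = ∑ j, (N : ℝ)⁻¹ * (u j).1 i := by simp [z]
      have hz' : z'.1 i = ∑ j, (N : ℝ)⁻¹ * (u' j).1 i := by simp [z']
      rw [PiLp.sub_apply, hz, hz', ← Finset.sum_sub_distrib, PiLp.smul_apply, smul_eq_mul,
        Finset.mul_sum]
      refine Finset.sum_congr rfl fun j _ => ?_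
      rw [← mul_sub, huv]
      ring
    rw [Subtype.dist_eq, dist_eq_norm, hzz, norm_smul, norm_piLp_ofReal hp0,
      Real.norm_of_nonneg (by positivity)]
    have h1 : (∑ i, |∑ j, ε j * v j i| ^ p) ^ (1 / p) ≤ (N : ℝ) ^ (1 / p) :=
      Real.rpow_le_rpow (by positivity) hsum (by positivity)
    calc 2 * (N : ℝ)⁻¹ * (∑ i, |∑ j, ε j * v j i| ^ p) ^ (1 / p)
        ≤ 2 * (N : ℝ)⁻¹ * (N : ℝ) ^ (1 / p) := by gcongr
      _ = (2 * (N : ℝ) ^ (1 / p)) / N := by ring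
      _ ≤ 1 := (div_le_one hNpos).2 hN
  linarith

theorem quarter_le_distQGH {p : ℝ} (hp1 : 1 ≤ p) (hp2 : p ≤ 2) {N : ℕ} (hN0 : 0 < N)
    (hN : 2 * (N : ℝ) ^ (1 / p) ≤ N) :
    1 / 4 ≤ (ellQMS p hp1 N).distQGH (ellQMS 1 le_rfl N) := by
  have : Fact (1 ≤ ENNReal.ofReal p) := ⟨ENNReal.one_le_ofReal.2 hp1⟩
  refine le_csInf ?_ ?_
  · exact ⟨_, _, admissible_bridgeLip (K := ellBall (ENNReal.ofReal p) N)
      (K' := ellBall (ENNReal.ofReal 1) N) (convex_closedBall _ _) (convex_closedBall _ _)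
      ⟨0, Metric.mem_closedBall_self zero_le_one⟩ ⟨0, Metric.mem_closedBall_self zero_le_one⟩, rfl⟩
  · rintro _ ⟨L, h, rfl⟩
    exact not_lt.1 (not_hausdorffDist_lt_quarter hp1 hp2 hN0 hN L h)

end QuantumDistance

/-! ### State spaces, the classical distance and the conclusion -/

section StateSpaces

open CompactQuantumMetricSpace

/-- Every state is evaluation at a unique point (`evalState_bijective`), and norming functionals
show that the Connes metric is the norm distance (`connesDist_evalState`). -/
theorem stateSpaceIsEllBall_ellQMS (p : ℝ) (hp : 1 ≤ p) (N : ℕ) :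
    StateSpaceIsEllBall (ellQMS p hp N) p N := by
  have : Fact (1 ≤ ENNReal.ofReal p) := ⟨ENNReal.one_le_ofReal.2 hp⟩
  have hp0 : 0 < p := by linarith
  have hK : Convex ℝ (ellBall (ENNReal.ofReal p) N) := convex_closedBall _ _
  let e₁ : {x : Fin N → ℝ // (∑ i, |x i| ^ p) ^ (1 / p) ≤ 1} ≃ ellBall (ENNReal.ofReal p) N :=
    (WithLp.equiv (ENNReal.ofReal p) (Fin N → ℝ)).symm.subtypeEquiv fun x => by
      rw [mem_closedBall_zero_iff, norm_piLp_ofReal hp0]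
      rfl
  let e₂ : ellBall (ENNReal.ofReal p) N ≃ State (affSystem (ellBall (ENNReal.ofReal p) N)) :=
    Equiv.ofBijective _ (evalState_bijective hK)
  refine ⟨e₁.trans e₂, fun x y => ?_, fun x y z t h0 h1 hz f => ?_⟩
  · refine (congrArg ENNReal.toReal (connesDist_evalState (e₁ x) (e₁ y))).trans ?_
    rw [ENNReal.toReal_ofReal dist_nonneg, Subtype.dist_eq, dist_eq_norm, norm_piLp_ofReal hp0]
    rfl
  · refine isAffineFun_affSystem f (e₁ x) (e₁ y) (e₁ z) t h0 h1 ?_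
    exact congrArg (WithLp.toLp (ENNReal.ofReal p)) hz

/-- The coordinatewise Mazur map is a surjection whose distortion is bounded independently of `N`;
half the distortion bounds the Gromov–Hausdorff distance. -/
theorem distGH_le_of_stateSpaceIsEllBall {𝒳 𝒴 : CompactQuantumMetricSpace} {p : ℝ} {N : ℕ}
    (hp : 1 ≤ p) (h𝒳 : StateSpaceIsEllBall 𝒳 p N) (h𝒴 : StateSpaceIsEllBall 𝒴 1 N) :
    𝒳.distGH 𝒴 ≤ (4 * (2 ^ (p - 1) - 1) + (p - 1)) / 2 := by
  obtain ⟨e, he, -⟩ := h𝒳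
  obtain ⟨e₁, he₁, -⟩ := h𝒴
  have hp0 : 0 < p := by linarith
  have hη : (0 : ℝ) ≤ 2 ^ (p - 1) - 1 := sub_nonneg.2 (Real.one_le_rpow (by norm_num) (by linarith))
  have hball : ∀ x : {x : Fin N → ℝ // (∑ i, |x i| ^ p) ^ (1 / p) ≤ 1}, ∑ i, |x.1 i| ^ p ≤ 1 :=
    fun x => (rpow_one_div_le_one_iff hp0 (by positivity)).1 x.2
  let m : {x : Fin N → ℝ // (∑ i, |x i| ^ p) ^ (1 / p) ≤ 1} →
      {x : Fin N → ℝ // (∑ i, |x i| ^ (1 : ℝ)) ^ (1 / (1 : ℝ)) ≤ 1} := fun x =>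
    ⟨fun i => mazur p (x.1 i), by simpa [abs_mazur hp0] using hball x⟩
  have hsurj : Function.Surjective m := by
    intro y
    have hy : ∑ i, |y.1 i| ≤ 1 := by simpa using y.2
    refine ⟨⟨fun i => mazur p⁻¹ (y.1 i), ?_⟩, ?_⟩
    · rw [rpow_one_div_le_one_iff hp0 (by positivity)]
      simpa [abs_mazur (inv_pos.2 hp0), Real.rpow_inv_rpow, hp0.ne'] using hy
    · exact Subtype.ext (funext fun i => mazur_mazur_inv hp0 _)
  have hdist : ∀ x y, |dist (e x) (e y) - dist (e₁ (m x)) (e₁ (m y))| ≤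
      4 * (2 ^ (p - 1) - 1) + (p - 1) := by
    intro x y
    have hS0 : 0 ≤ ∑ i, |x.1 i - y.1 i| ^ p := by positivity
    have hu0 : 0 ≤ dist (e x) (e y) := dist_nonneg
    have hpow : dist (e x) (e y) ^ p = ∑ i, |x.1 i - y.1 i| ^ p := by
      rw [he, ← Real.rpow_mul hS0, one_div_mul_cancel hp0.ne', Real.rpow_one]
    -- The diameter bound supplies the hypothesis `u ≤ 2` of `abs_rpow_sub_self_le`.
    have hu2 : dist (e x) (e y) ≤ 2 := by
      have hbound : ∑ i, |x.1 i - y.1 i| ^ p ≤ 2 ^ p := by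
        calc ∑ i, |x.1 i - y.1 i| ^ p
            ≤ ∑ i, 2 ^ (p - 1) * (|x.1 i| ^ p + |y.1 i| ^ p) :=
              Finset.sum_le_sum fun i _ =>
                (Real.rpow_le_rpow (abs_nonneg _) (abs_sub _ _) hp0.le).trans
                  (add_rpow_le_two_rpow_mul hp (abs_nonneg _) (abs_nonneg _))
          _ = 2 ^ (p - 1) * (∑ i, |x.1 i| ^ p + ∑ i, |y.1 i| ^ p) := by
              rw [← Finset.mul_sum, Finset.sum_add_distrib]
          _ ≤ 2 ^ (p - 1) * 2 := by
              gcongr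
              linarith [hball x, hball y]
          _ = 2 ^ p := by
              rw [← Real.rpow_add_one (by norm_num), sub_add_cancel]
      rw [← hpow] at hbound
      exact (Real.rpow_le_rpow_iff hu0 (by norm_num) hp0).1 hbound
    have h1 := abs_rpow_sub_self_le hp hu0 hu2
    have h2 : |dist (e x) (e y) ^ p - dist (e₁ (m x)) (e₁ (m y))| ≤ 2 * (2 ^ (p - 1) - 1) := by
      rw [hpow, he₁]
      simp only [Real.rpow_one, one_div_one, m]
      rw [← Finset.sum_sub_distrib]
      refine (Finset.abs_sum_le_sum_abs _ _).trans
        ((Finset.sum_le_sum fun i _ => abs_sub_mazur_le hp (x.1 i) (y.1 i)).trans ?_)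
      rw [← Finset.mul_sum, Finset.sum_add_distrib, mul_comm]
      exact mul_le_mul_of_nonneg_right (by linarith [hball x, hball y]) hη
    rw [abs_le] at h1 h2 ⊢
    constructor <;> linarith
  -- Both density errors are `0`: the map is defined on the whole space and is onto.
  have hgh := GromovHausdorff.ghDist_le_of_approx_subsets (X := 𝒳.StateSpace) (Y := 𝒴.StateSpace)
    (s := univ) (fun x => e₁ (m (e.symm x.1))) (ε₁ := 0)
    (ε₂ := 4 * (2 ^ (p - 1) - 1) + (p - 1)) (ε₃ := 0)
    (fun x => ⟨x, mem_univ x, (dist_self x).le⟩)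
    (fun y => by
      obtain ⟨x, hx⟩ := hsurj (e₁.symm y)
      exact ⟨⟨e x, mem_univ _⟩, by simp [hx]⟩)
    (fun x y => by
      have h := hdist (e.symm x.1) (e.symm y.1)
      rwa [e.apply_symm_apply, e.apply_symm_apply] at h)
  rw [zero_add, add_zero] at hgh
  exact hgh

/-- Since `p > 1`, `N^(1 - 1/p)` tends to infinity and eventually exceeds `2`. Positivity is
recorded separately, as `N = 0` satisfies the inequality too. -/
theorem exists_forall_two_mul_rpow_le {p : ℝ} (hp : 1 < p) :
    ∃ M : ℕ, ∀ N : ℕ, M ≤ N → 0 < N ∧ 2 * (N : ℝ) ^ (1 / p) ≤ N := by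
  have hexp : 0 < 1 - 1 / p := sub_pos.2 ((div_lt_one (by linarith)).2 hp)
  have ht := ((tendsto_rpow_atTop hexp).comp tendsto_natCast_atTop_atTop).eventually_ge_atTop 2
  obtain ⟨M, hM⟩ := eventually_atTop.1 (ht.and (eventually_gt_atTop 0))
  refine ⟨M, fun N hN => ⟨(hM N hN).2, ?_⟩⟩
  have hN0 : (0 : ℝ) < N := by exact_mod_cast (hM N hN).2
  calc 2 * (N : ℝ) ^ (1 / p) ≤ (N : ℝ) ^ (1 - 1 / p) * (N : ℝ) ^ (1 / p) := by
        gcongr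
        exact (hM N hN).1
    _ = N := by rw [← Real.rpow_add hN0, sub_add_cancel, Real.rpow_one]

/-- Only the quantum bound requires `N` to be large; the classical bound depends on `p` alone, so
any larger `N` is allowed. -/
theorem exists_tendsto_distGH_and_quarter_le_distQGH (p : ℕ → ℝ) (hp : ∀ n, 1 < p n ∧ p n < 2)
    (hlim : Tendsto p atTop (𝓝 1)) :
    ∃ M : ℕ → ℕ, ∀ N : ℕ → ℕ, (∀ n, M n ≤ N n) →
      Tendsto (fun n => (ellQMS (p n) (hp n).1.le (N n)).distGH (ellQMS 1 le_rfl (N n)))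
        atTop (𝓝 0) ∧
      ∀ n, 1 / 4 ≤ (ellQMS (p n) (hp n).1.le (N n)).distQGH (ellQMS 1 le_rfl (N n)) := by
  choose M hM using fun n => exists_forall_two_mul_rpow_le (hp n).1
  refine ⟨M, fun N hN => ⟨?_, fun n =>
    quarter_le_distQGH _ (hp n).2.le (hM n _ (hN n)).1 (hM n _ (hN n)).2⟩⟩
  have hcont : Continuous fun q : ℝ => (4 * ((2 : ℝ) ^ (q - 1) - 1) + (q - 1)) / 2 := by
    have : Continuous fun q : ℝ => (2 : ℝ) ^ (q - 1) :=
      (Real.continuous_const_rpow two_ne_zero).comp (by fun_prop)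
    fun_prop
  have hbound := (hcont.tendsto 1).comp hlim
  simp only [sub_self, Real.rpow_zero, mul_zero, add_zero, zero_div] at hbound
  exact squeeze_zero (fun n => dist_nonneg)
    (fun n => distGH_le_of_stateSpaceIsEllBall (hp n).1.le (stateSpaceIsEllBall_ellQMS _ _ _)
      (stateSpaceIsEllBall_ellQMS _ _ _)) hbound

theorem not_exists_distQGH_le_mul_distGH :
    ¬ ∃ C : ℝ, 0 < C ∧ ∀ 𝒳 𝒴 : CompactQuantumMetricSpace, 𝒳.distQGH 𝒴 ≤ C * 𝒳.distGH 𝒴 := by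
  rintro ⟨C, -, hC⟩
  have hp : ∀ n : ℕ, 1 < 1 + 1 / ((n : ℝ) + 2) ∧ 1 + 1 / ((n : ℝ) + 2) < 2 := by
    intro n
    have h1 : 0 < 1 / ((n : ℝ) + 2) := by positivity
    have h2 : 1 / ((n : ℝ) + 2) < 1 :=
      (div_lt_one (by positivity)).2 (by linarith [n.cast_nonneg (α := ℝ)])
    constructor <;> linarith
  have hlim : Tendsto (fun n : ℕ => 1 + 1 / ((n : ℝ) + 2)) atTop (𝓝 1) := by
    have h := (tendsto_const_nhds (x := (1 : ℝ))).div_atTop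
      (tendsto_atTop_add_const_right atTop (2 : ℝ) (tendsto_natCast_atTop_atTop (R := ℝ)))
    simpa using h.const_add 1
  obtain ⟨M, hM⟩ := exists_tendsto_distGH_and_quarter_le_distQGH _ hp hlim
  obtain ⟨h1, h2⟩ := hM M fun _ => le_rfl
  -- Along the sequence `C * distGH` tends to `0` while staying at least `1/4`.
  have h3 := ge_of_tendsto' (h1.const_mul C) fun n => (h2 n).trans (hC _ _)
  norm_num at h3

end StateSpaces

theorem theoremA :
    (¬ ∃ C : ℝ, 0 < C ∧ ∀ 𝒳 𝒴 : CompactQuantumMetricSpace, 𝒳.distQGH 𝒴 ≤ C * 𝒳.distGH 𝒴) ∧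
    (∀ (p : ℝ) (hp : 1 ≤ p) (N : ℕ), StateSpaceIsEllBall (ellQMS p hp N) p N) ∧
    ∀ (p : ℕ → ℝ) (hp : ∀ n, 1 < p n ∧ p n < 2), Tendsto p atTop (𝓝 1) →
      ∃ M : ℕ → ℕ, ∀ N : ℕ → ℕ, (∀ n, M n ≤ N n) →
        Tendsto (fun n => (ellQMS (p n) (hp n).1.le (N n)).distGH (ellQMS 1 le_rfl (N n)))
          atTop (𝓝 0) ∧
        ∀ n, 1 / 4 ≤ (ellQMS (p n) (hp n).1.le (N n)).distQGH (ellQMS 1 le_rfl (N n)) := by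
  exact ⟨not_exists_distQGH_le_mul_distGH, stateSpaceIsEllBall_ellQMS,
    exists_tendsto_distGH_and_quarter_le_distQGH⟩
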